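/- Let $N\ge 1$, $d\ge 2$, $t\in\mathbb T=\{0,\dots,N-1\}$, and write $\mathbb T_k=\{k,\dots,N-1\}$. Let $w_0,\dots,w_{N-1}$ be real square-integrable random variables on a probability space, $\mathcal F_k=\sigma(w_0,\dots,w_{k-1})$ ($\mathcal F_0$ trivial), $\mathbb E[w_k\mid\mathcal F_k]=0$ and $\mathbb E[w_k^2\mid\mathcal F_k]=1$ for $k\in\mathbb T$. Let $A_k,C_k\in\mathbb R^{n\times n}$, $B_k,D_k\in\mathbb R^{n\times m}$ be deterministic and let $Q_k\in\mathbb R^{n\times n}$, $R_k\in\mathbb R^{m\times m}$ ($k\in\mathbb T_t$), $G\in\mathbb R^{n\times n}$ be symmetric (no definiteness is assumed). For $k\in\mathbb T_t$ and an initial state $\xi$ consider $$X_{\ell+1}=(A_\ell X_\ell+B_\ell u_\ell)+(C_\ell X_\ell+D_\ell u_\ell)w_\ell,\quad X_k=\xi,\ \ell\in\mathbb T_k,$$ $$J(k,\xi;u)=\sum_{\ell=k}^{N-1}\mathbb E[X_\ell^TQ_\ell X_\ell+u_\ell^TR_\ell u_\ell]+\mathbb E[X_N^TGX_N].$$ $t$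 is fixed, and $\mathcal U^k_{ad}$ is the set of $u=(u_k,\dots,u_{N-1})$ such that each $u_\ell$ is $\mathbb R^m$-valued, square integrable and $\mathcal F_{\max(t,\ell-d)}$-measurable; controls that agree almost surely are identified. Write $\mathbb E_{\ell-d}=\mathbb E[\,\cdot\mid\mathcal F_{\max(t,\ell-d)}]$. The problem is uniquely solvable at $(k,\xi)$ if $J(k,\xi;\cdot)$ has exactly one minimizer (the optimal control) over $\mathcal U^k_{ad}$. The map $u\mapsto J(k,\xi;u)$ is called uniformly convex on $\mathcal U^k_{ad}$ if there is $\lambda>0$ with $J(k,0;u)\ge\lambda\sum_{\ell=k}^{N-1}\mathbb E|u_\ell|^2$ for all $u\in\mathcal U^k_{ad}$ (a condition that does not depend on $\xi$). For matrices $P^{(i)}_k\in\mathbb R^{n\times n}$ put, for $k\in\mathbb T_t$ and $r_k=\min(d,k+1-t)$, $$W_k=R_k+\sum_{i=0}^{r_k}B_k^TP^{(i)}_{k+1}B_k+D_k^TP^{(0)}_{k+1}D_k,\qquad H_k=\sum_{i=0}^{r_k}B_k^TP^{(i)}_{k+1}A_k+D_k^TP^{(0)}_{k+1}C_k .$$ The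 constrained Riccati-like equations are: $P^{(0)}_N=G$, $P^{(j)}_N=0$ for $1\le j\le d$; $$P^{(0)}_k=Q_k+A_k^T(P^{(0)}_{k+1}+P^{(1)}_{k+1})A_k+C_k^TP^{(0)}_{k+1}C_k\quad(t<k\le N-1);$$ $$P^{(i)}_k=A_k^TP^{(i+1)}_{k+1}A_k\ (1\le i\le d-1),\quad P^{(d)}_k=-H_k^TW_k^\dagger H_k\quad(t+d\le k\le N-1);$$ $$P^{(i)}_k=A_k^TP^{(i+1)}_{k+1}A_k\ (1\le i\le k-t-1),\quad P^{(k-t)}_k=A_k^TP^{(k+1-t)}_{k+1}A_k-H_k^TW_k^\dagger H_k\quad(t+1\le k\le t+d-1,\ k\le N-1);$$ $$P^{(0)}_t=Q_t+A_t^T(P^{(0)}_{t+1}+P^{(1)}_{t+1})A_t+C_t^TP^{(0)}_{t+1}C_t-H_t^TW_t^\dagger H_t;$$ together with $W_kW_k^\dagger H_k=H_k$ and $W_k\ge0$ for all $k\in\mathbb T_t$, where $\dagger$ is the Moore--Penrose inverse. **Theorem.** Let $x$ be a square-integrable $\mathcal F_t$-measurable $\mathbb R^n$-valued random variable. The following are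 equivalent: (i) the problem is uniquely solvable at $(t,x)$; (ii) the constrained Riccati-like equations have a solution, with $W_k>0$ for all $k\in\mathbb T_t$; (iii) $u\mapsto J(t,x;u)$ is uniformly convex on $\mathcal U^t_{ad}$; (iv) for every $k\in\mathbb T_t$, $u\mapsto J(k,\xi;u)$ is uniformly convex on $\mathcal U^k_{ad}$; (v) the problem is uniquely solvable at every $(k,\xi)\in\mathbb T_t\times\mathbb R^n$. If these conditions hold, then for every solution of the constrained Riccati-like equations and every initial pair $(k,\xi)\in\mathbb T_t\times\mathbb R^n$, and also for the initial pair $(t,x)$ (with $k=t$, $\xi=x$), the unique optimal control is $u_\ell=-W_\ell^{-1}H_\ell\,\mathbb E_{\ell-d}X_\ell$, $\ell\in\mathbb T_k$, where $$X_{\ell+1}=(A_\ell X_\ell-B_\ell W_\ell^{-1}H_\ell\mathbb E_{\ell-d}X_\ell)+(C_\ell X_\ell-D_\ell W_\ell^{-1}H_\ell\mathbb E_{\ell-d}X_\ell)w_\ell,\quad X_k=\xi,\ \ell\in\mathbb T_k .$$ -/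

import Mathlib

open MeasureTheory Matrix

namespace DelayedLQ

/-! ### Moore-Penrose inverse of a real matrix -/

/-- The four Penrose equations: `X` is the Moore-Penrose inverse of `M`. -/
structure IsMoorePenrose {p q : ℕ} (M : Matrix (Fin p) (Fin q) ℝ)
    (X : Matrix (Fin q) (Fin p) ℝ) : Prop where
  mul_mul_self : M * X * M = M
  mul_mul_inv : X * M * X = X
  symm_left : (M * X)ᵀ = M * X
  symm_right : (X * M)ᵀ = X * M

theorem IsMoorePenrose.unique {p q : ℕ} {M : Matrix (Fin p) (Fin q) ℝ}
    {X Y : Matrix (Fin q) (Fin p) ℝ} (hX : IsMoorePenrose M X) (hY : IsMoorePenrose M Y) :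
    X = Y := by
  have h1 : M * X = M * Y := by
    calc M * X = (M * X)ᵀ := hX.symm_left.symm
      _ = (M * Y * (M * X))ᵀ := by rw [← Matrix.mul_assoc, hY.mul_mul_self]
      _ = M * X * (M * Y) := by rw [Matrix.transpose_mul, hX.symm_left, hY.symm_left]
      _ = M * Y := by rw [← Matrix.mul_assoc, hX.mul_mul_self]
  have h2 : X * M = Y * M := by
    calc X * M = (X * M)ᵀ := hX.symm_right.symm
      _ = (X * M * (Y * M))ᵀ := by
          rw [Matrix.mul_assoc X M, ← Matrix.mul_assoc M Y, hY.mul_mul_self]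
      _ = Y * M * (X * M) := by rw [Matrix.transpose_mul, hX.symm_right, hY.symm_right]
      _ = Y * M := by rw [Matrix.mul_assoc Y M, ← Matrix.mul_assoc M X, hX.mul_mul_self]
  calc X = X * M * X := hX.mul_mul_inv.symm
    _ = Y * M * Y := by rw [h2, Matrix.mul_assoc, h1, ← Matrix.mul_assoc]
    _ = Y := hY.mul_mul_inv

theorem exists_isMoorePenrose_of_isSymm {q : ℕ} (S : Matrix (Fin q) (Fin q) ℝ)
    (hS : S.IsSymm) : ∃ X, IsMoorePenrose S X ∧ X.IsSymm := by
  have hH : S.IsHermitian := by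
    rw [Matrix.IsHermitian, Matrix.conjTranspose_eq_transpose_of_trivial]; exact hS
  obtain ⟨U, D, hU, hSU⟩ : ∃ (U : Matrix (Fin q) (Fin q) ℝ) (D : Fin q → ℝ),
      Uᵀ * U = 1 ∧ S = U * diagonal D * Uᵀ := by
    refine ⟨hH.eigenvectorUnitary, hH.eigenvalues, ?_, ?_⟩
    · have := Unitary.coe_star_mul_self hH.eigenvectorUnitary
      rwa [Matrix.star_eq_conjTranspose, Matrix.conjTranspose_eq_transpose_of_trivial] at this
    · have := hH.spectral_theorem
      rw [Unitary.conjStarAlgAut_apply, Matrix.star_eq_conjTranspose,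
        Matrix.conjTranspose_eq_transpose_of_trivial] at this
      exact this
  have key : ∀ a b : Fin q → ℝ, (U * diagonal a * Uᵀ) * (U * diagonal b * Uᵀ)
      = U * diagonal (fun i => a i * b i) * Uᵀ := by
    intro a b
    calc (U * diagonal a * Uᵀ) * (U * diagonal b * Uᵀ)
        = U * diagonal a * (Uᵀ * U) * diagonal b * Uᵀ := by simp only [Matrix.mul_assoc]
      _ = _ := by rw [hU, Matrix.mul_one, Matrix.mul_assoc U, Matrix.diagonal_mul_diagonal]
  have symm : ∀ a : Fin q → ℝ, (U * diagonal a * Uᵀ)ᵀ = U * diagonal a * Uᵀ := by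
    intro a
    simp [Matrix.transpose_mul, Matrix.mul_assoc]
  refine ⟨U * diagonal (fun i => (D i)⁻¹) * Uᵀ, ⟨?_, ?_, ?_, ?_⟩, symm _⟩
  · rw [hSU, key, key]
    have h : (fun i => D i * (D i)⁻¹ * D i) = D := by
      funext i; exact mul_inv_mul_cancel (D i)
    rw [h]
  · rw [hSU, key, key]
    have h : (fun i => (D i)⁻¹ * D i * (D i)⁻¹) = fun i => (D i)⁻¹ := by
      funext i; simpa using mul_inv_mul_cancel (D i)⁻¹
    rw [h]
  · rw [hSU, key, symm]
  · rw [hSU, key, symm]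

theorem exists_isMoorePenrose {p q : ℕ} (M : Matrix (Fin p) (Fin q) ℝ) :
    ∃ X, IsMoorePenrose M X := by
  have hS : (Mᵀ * M).IsSymm := by simp [Matrix.IsSymm, Matrix.transpose_mul]
  obtain ⟨X, hX, hXs⟩ := exists_isMoorePenrose_of_isSymm (Mᵀ * M) hS
  have hXs' : Xᵀ = X := hXs
  have h0 : M * (X * (Mᵀ * M) - 1) = 0 := by
    rw [← Matrix.conjTranspose_mul_self_eq_zero, Matrix.conjTranspose_eq_transpose_of_trivial,
      Matrix.transpose_mul]
    calc (X * (Mᵀ * M) - 1)ᵀ * Mᵀ * (M * (X * (Mᵀ * M) - 1))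
        = (X * (Mᵀ * M) - 1)ᵀ * ((Mᵀ * M) * X * (Mᵀ * M) - Mᵀ * M) := by
          simp only [Matrix.mul_assoc, Matrix.mul_sub, Matrix.mul_one]
      _ = 0 := by rw [hX.mul_mul_self, sub_self, Matrix.mul_zero]
  refine ⟨X * Mᵀ, ⟨?_, ?_, ?_, ?_⟩⟩
  · rw [Matrix.mul_sub, Matrix.mul_one, sub_eq_zero] at h0
    simpa only [Matrix.mul_assoc] using h0
  · have h := hX.mul_mul_inv
    calc X * Mᵀ * M * (X * Mᵀ) = X * (Mᵀ * M) * X * Mᵀ := by simp only [Matrix.mul_assoc]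
      _ = X * Mᵀ := by rw [h]
  · simp [Matrix.transpose_mul, Matrix.mul_assoc, hXs']
  · rw [Matrix.mul_assoc]; exact hX.symm_right

/-- The Moore-Penrose inverse `M†`. -/
noncomputable def pinv {p q : ℕ} (M : Matrix (Fin p) (Fin q) ℝ) : Matrix (Fin q) (Fin p) ℝ :=
  Classical.choose (exists_isMoorePenrose M)

theorem pinv_spec {p q : ℕ} (M : Matrix (Fin p) (Fin q) ℝ) : IsMoorePenrose M (pinv M) :=
  Classical.choose_spec (exists_isMoorePenrose M)

/-! ### The controlled system and the cost -/

/-- The matrices of the problem: state dimension `n`, control dimension `m`. -/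
structure LQData (n m : ℕ) where
  A : ℕ → Matrix (Fin n) (Fin n) ℝ
  B : ℕ → Matrix (Fin n) (Fin m) ℝ
  C : ℕ → Matrix (Fin n) (Fin n) ℝ
  D : ℕ → Matrix (Fin n) (Fin m) ℝ
  Q : ℕ → Matrix (Fin n) (Fin n) ℝ
  R : ℕ → Matrix (Fin m) (Fin m) ℝ
  G : Matrix (Fin n) (Fin n) ℝ

section Stochastic

variable {Ω : Type*}

/-- `F_k = σ(w_0, …, w_{k-1})`; in particular `F_0` is the trivial σ-algebra. -/
abbrev history (w : ℕ → Ω → ℝ) (k : ℕ) : MeasurableSpace Ω :=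
  ⨆ l : ℕ, ⨆ _ : l < k, MeasurableSpace.comap (w l) inferInstance

/-- The information available to the controller at time `l` when the delay is `d` and the initial
time is `t`: `F_{l-d}` if `t + d ≤ l`, and `F_t` if `t ≤ l ≤ t + d`. -/
abbrev info (w : ℕ → Ω → ℝ) (d t l : ℕ) : MeasurableSpace Ω := history w (max t (l - d))

variable [MeasurableSpace Ω]

/-- `w_0, …, w_{N-1}` is a square integrable martingale difference sequence with unit conditional
second moments. -/
structure IsNoise (μ : Measure Ω) (N : ℕ) (w : ℕ → Ω → ℝ) : Prop where
  measurable : ∀ k < N, Measurable (w k)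
  memLp : ∀ k < N, MemLp (w k) 2 μ
  condExp_eq_zero : ∀ k < N, μ[w k | history w k] =ᵐ[μ] fun _ => 0
  condExp_sq_eq_one : ∀ k < N, μ[fun ω => w k ω ^ 2 | history w k] =ᵐ[μ] fun _ => 1

variable {n m : ℕ}

/-- The state with `X_k = ξ` and
`X_{l+1} = (A_l X_l + B_l u_l) + (C_l X_l + D_l u_l) w_l` for `l ≥ k`
(the values at times before `k` play no role and are set to `ξ`). -/
def state (S : LQData n m) (w : ℕ → Ω → ℝ) (k : ℕ) (ξ : Ω → Fin n → ℝ)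
    (u : ℕ → Ω → Fin m → ℝ) : ℕ → Ω → Fin n → ℝ
  | 0 => ξ
  | l + 1 => if l < k then ξ else fun ω =>
      (S.A l *ᵥ state S w k ξ u l ω + S.B l *ᵥ u l ω)
        + w l ω • (S.C l *ᵥ state S w k ξ u l ω + S.D l *ᵥ u l ω)

/-- The cost `J(k, ξ; u)`. -/
noncomputable def cost (μ : Measure Ω) (S : LQData n m) (N : ℕ) (w : ℕ → Ω → ℝ) (k : ℕ)
    (ξ : Ω → Fin n → ℝ) (u : ℕ → Ω → Fin m → ℝ) : ℝ :=
  (∑ l ∈ Finset.Ico k N,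
      ∫ ω, (state S w k ξ u l ω ⬝ᵥ (S.Q l *ᵥ state S w k ξ u l ω)
        + u l ω ⬝ᵥ (S.R l *ᵥ u l ω)) ∂μ)
    + ∫ ω, state S w k ξ u N ω ⬝ᵥ (S.G *ᵥ state S w k ξ u N ω) ∂μ

/-- Admissible controls `(u_k, …, u_{N-1})`: each `u_l` is square integrable and measurable with
respect to the delayed information. Only the values at times `k, …, N-1` matter. -/
def Admissible (μ : Measure Ω) (N d t : ℕ) (w : ℕ → Ω → ℝ) (k : ℕ)
    (u : ℕ → Ω → Fin m → ℝ) : Prop :=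
  ∀ l, k ≤ l → l < N → Measurable[info w d t l] (u l) ∧ MemLp (u l) 2 μ

/-- `v` is an optimal control for the initial pair `(k, ξ)`. -/
def IsOptimal (μ : Measure Ω) (S : LQData n m) (N d t : ℕ) (w : ℕ → Ω → ℝ) (k : ℕ)
    (ξ : Ω → Fin n → ℝ) (v : ℕ → Ω → Fin m → ℝ) : Prop :=
  Admissible μ N d t w k v ∧
    ∀ u, Admissible μ N d t w k u → cost μ S N w k ξ v ≤ cost μ S N w k ξ u

/-- `v` is the only optimal control for `(k, ξ)`, controls being identified when they agree almost
surely at the times `k, …, N-1`. -/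
def IsUniqueOptimal (μ : Measure Ω) (S : LQData n m) (N d t : ℕ) (w : ℕ → Ω → ℝ) (k : ℕ)
    (ξ : Ω → Fin n → ℝ) (v : ℕ → Ω → Fin m → ℝ) : Prop :=
  IsOptimal μ S N d t w k ξ v ∧
    ∀ u, IsOptimal μ S N d t w k ξ u → ∀ l, k ≤ l → l < N → u l =ᵐ[μ] v l

/-- The problem is uniquely solvable at `(k, ξ)`. -/
def UniquelySolvable (μ : Measure Ω) (S : LQData n m) (N d t : ℕ) (w : ℕ → Ω → ℝ) (k : ℕ)
    (ξ : Ω → Fin n → ℝ) : Prop :=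
  ∃ v, IsUniqueOptimal μ S N d t w k ξ v

/-- Uniform convexity of `u ↦ J(k, ξ; u)` on the admissible controls from time `k`:
`J(k, 0; u) ≥ λ ∑ E|u_l|²` for some `λ > 0`. The second-order part of `J(k, ξ; ·)`, hence this
condition, does not depend on `ξ`. -/
def UniformlyConvex (μ : Measure Ω) (S : LQData n m) (N d t : ℕ) (w : ℕ → Ω → ℝ) (k : ℕ) : Prop :=
  ∃ c : ℝ, 0 < c ∧ ∀ u : ℕ → Ω → Fin m → ℝ, Admissible μ N d t w k u →
    c * ∑ l ∈ Finset.Ico k N, ∫ ω, u l ω ⬝ᵥ u l ω ∂μ ≤ cost μ S N w k (fun _ => 0) u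

/-- The closed-loop state for the feedback `u_l = -K_l E[X_l | info_l]`:
`X_k = ξ` and `X_{l+1} = (A_l X_l - B_l K_l E[X_l | info_l]) + (C_l X_l - D_l K_l E[X_l | info_l]) w_l`
for `l ≥ k`. -/
noncomputable def closedLoopState (μ : Measure Ω) (S : LQData n m) (d t : ℕ) (w : ℕ → Ω → ℝ)
    (K : ℕ → Matrix (Fin m) (Fin n) ℝ) (k : ℕ) (ξ : Ω → Fin n → ℝ) : ℕ → Ω → Fin n → ℝ
  | 0 => ξ
  | l + 1 => if l < k then ξ else fun ω =>
      (S.A l *ᵥ closedLoopState μ S d t w K k ξ l ω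
          - S.B l *ᵥ (K l *ᵥ (μ[closedLoopState μ S d t w K k ξ l | info w d t l]) ω))
        + w l ω • (S.C l *ᵥ closedLoopState μ S d t w K k ξ l ω
          - S.D l *ᵥ (K l *ᵥ (μ[closedLoopState μ S d t w K k ξ l | info w d t l]) ω))

/-- The feedback control `u_l = -K_l E[X_l | info_l]` along the closed-loop state. -/
noncomputable def feedbackControl (μ : Measure Ω) (S : LQData n m) (d t : ℕ) (w : ℕ → Ω → ℝ)
    (K : ℕ → Matrix (Fin m) (Fin n) ℝ) (k : ℕ) (ξ : Ω → Fin n → ℝ) : ℕ → Ω → Fin m → ℝ :=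
  fun l ω => -(K l *ᵥ (μ[closedLoopState μ S d t w K k ξ l | info w d t l]) ω)

end Stochastic

/-! ### The Riccati-like equations

A family `P` is indexed so that `P i k` is `P^{(i)}_k`. -/

section Riccati

variable {n m : ℕ}

/-- `W_k = R_k + ∑_i B_kᵀ P^{(i)}_{k+1} B_k + D_kᵀ P^{(0)}_{k+1} D_k`, where `i` runs over
`0, …, d` if `k ≥ t + d` and over `0, …, k + 1 - t` if `t ≤ k ≤ t + d - 1`. -/
def W (S : LQData n m) (d t : ℕ) (P : ℕ → ℕ → Matrix (Fin n) (Fin n) ℝ) (k : ℕ) :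
    Matrix (Fin m) (Fin m) ℝ :=
  S.R k + ∑ i ∈ Finset.range (min d (k + 1 - t) + 1), (S.B k)ᵀ * P i (k + 1) * S.B k
    + (S.D k)ᵀ * P 0 (k + 1) * S.D k

/-- `H_k = ∑_i B_kᵀ P^{(i)}_{k+1} A_k + D_kᵀ P^{(0)}_{k+1} C_k`, with the same range of `i` as in
`W_k`. -/
def H (S : LQData n m) (d t : ℕ) (P : ℕ → ℕ → Matrix (Fin n) (Fin n) ℝ) (k : ℕ) :
    Matrix (Fin m) (Fin n) ℝ :=
  ∑ i ∈ Finset.range (min d (k + 1 - t) + 1), (S.B k)ᵀ * P i (k + 1) * S.A k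
    + (S.D k)ᵀ * P 0 (k + 1) * S.C k

/-- `P` solves the constrained Riccati-like equations on `{t, …, N}`. -/
structure IsRiccatiSolution (S : LQData n m) (N d t : ℕ)
    (P : ℕ → ℕ → Matrix (Fin n) (Fin n) ℝ) : Prop where
  /- terminal values -/
  terminal_zero : P 0 N = S.G
  terminal : ∀ j, 1 ≤ j → j ≤ d → P j N = 0
  /- the equation of `P^{(0)}_k` at all times after the initial one -/
  zero : ∀ k, t < k → k < N →
    P 0 k = S.Q k + (S.A k)ᵀ * (P 0 (k + 1) + P 1 (k + 1)) * S.A k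
      + (S.C k)ᵀ * P 0 (k + 1) * S.C k
  /- the linear equations, `k ≥ t + d` -/
  late_linear : ∀ k, t + d ≤ k → k < N → ∀ i, 1 ≤ i → i ≤ d - 1 →
    P i k = (S.A k)ᵀ * P (i + 1) (k + 1) * S.A k
  /- the equation of `P^{(d)}_k`, `k ≥ t + d` -/
  late_last : ∀ k, t + d ≤ k → k < N →
    P d k = -((H S d t P k)ᵀ * pinv (W S d t P k) * H S d t P k)
  /- the linear equations, `t + 1 ≤ k ≤ t + d - 1` (there are none for `k = t + 1`) -/
  early_linear : ∀ k, t + 1 ≤ k → k < t + d → k < N → ∀ i, 1 ≤ i → i < k - t →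
    P i k = (S.A k)ᵀ * P (i + 1) (k + 1) * S.A k
  /- the equation of `P^{(k-t)}_k`, `t + 1 ≤ k ≤ t + d - 1` -/
  early_last : ∀ k, t + 1 ≤ k → k < t + d → k < N →
    P (k - t) k = (S.A k)ᵀ * P (k + 1 - t) (k + 1) * S.A k
      - (H S d t P k)ᵀ * pinv (W S d t P k) * H S d t P k
  /- the equation at the initial time -/
  initial : P 0 t = S.Q t + (S.A t)ᵀ * (P 0 (t + 1) + P 1 (t + 1)) * S.A t
      + (S.C t)ᵀ * P 0 (t + 1) * S.C t
      - (H S d t P t)ᵀ * pinv (W S d t P t) * H S d t P t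
  /- the constraints -/
  range_constraint : ∀ k, t ≤ k → k < N →
    W S d t P k * pinv (W S d t P k) * H S d t P k = H S d t P k
  posSemidef : ∀ k, t ≤ k → k < N → (W S d t P k).PosSemidef

end Riccati

end DelayedLQ

/-! The delay is absorbed by keeping every estimate of the state between full information and the
delayed one: the `value` at time l is V_l(X) = ∑ E[X̂_iᵀ P^{(i)}_l X̂_i] with X̂_i = E[X | F_{l-i}]
and 0 ≤ i ≤ min(d, l-t). The dynamics shift the index. For i ≥ 1 the noise w_l averages out of
E[X_{l+1} | F_{l+1-i}], which becomes A_l E[X_l | F_{l-(i-1)}] + B_l u_l; for i = 0 it adds the form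
of P^{(0)}_{l+1} at C_l X_l + D_l u_l. Since u_l is measurable for the delayed information, every
cross term with u_l sees only X̂ = E_{l-d} X_l (`ip_control_condExp`), so the coefficients add up to
H_l and W_l. The Riccati-like equations then say that the running cost plus V_{l+1} is V_l +
E[X̂ᵀHᵀW†HX̂] + 2E[uᵀHX̂] + E[uᵀWu] (`value_step`), whatever the sign of W.

If every W_l is positive definite, completing the square and summing over time gives J(k, ξ; u) =
V_k(ξ) + ∑ E[δ_lᵀ W_l δ_l] with δ_l = u_l + W_l⁻¹H_l X̂_l (`cost_eq_value`). Hence the feedback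
control is the only minimizer. As controls and states are bounded, successively in time, by the δ_l,
the cost is also uniformly convex.

Conversely, unique solvability for a single initial state at time t, or uniform convexity at time t,
makes the homogeneous cost positive on nonzero controls (`StrictlyPositive`). Then W_k > 0 follows
by backward induction (`StrictlyPositive.posDef`): the control that is 0 before k, a constant y at k
and the feedback afterwards costs exactly yᵀW_k y (`cost_probe`). The backward recursion always
runs, because the pseudo-inverse always exists, and it determines all entries that enter W and H
(`IsRiccatiSolution.eq_riccati`); so every solution gives the same feedback. -/

namespace DelayedLQ

/-! ### Square integrable vectors and the forms `E[Yᵀ M Z]` -/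

section Pairing

variable {Ω : Type*} {m0 : MeasurableSpace Ω} {μ : Measure Ω} {p q r s : ℕ}

/-- The expectation `E[Yᵀ M Z]`. -/
noncomputable def ip (μ : Measure Ω) (M : Matrix (Fin p) (Fin q) ℝ) (Y : Ω → Fin p → ℝ)
    (Z : Ω → Fin q → ℝ) : ℝ := ∫ ω, Y ω ⬝ᵥ (M *ᵥ Z ω) ∂μ

/-- The bilinear form of a matrix as a continuous bilinear map. -/
noncomputable def bilin (M : Matrix (Fin p) (Fin q) ℝ) :
    (Fin p → ℝ) →L[ℝ] (Fin q → ℝ) →L[ℝ] ℝ :=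
  (Matrix.toLinearMap₂' ℝ M).toContinuousBilinearMap

theorem bilin_apply (M : Matrix (Fin p) (Fin q) ℝ) (y : Fin p → ℝ) (z : Fin q → ℝ) :
    bilin M y z = y ⬝ᵥ (M *ᵥ z) := by
  simp [bilin, Matrix.toLinearMap₂'_apply']

theorem memLp_mulVec (M : Matrix (Fin p) (Fin q) ℝ) {Y : Ω → Fin q → ℝ} (hY : MemLp Y 2 μ) :
    MemLp (fun ω => M *ᵥ Y ω) 2 μ :=
  (Matrix.mulVecLin M).toContinuousLinearMap.comp_memLp' hY

theorem measurable_mulVec (M : Matrix (Fin p) (Fin q) ℝ) {𝓕 : MeasurableSpace Ω}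
    {Y : Ω → Fin q → ℝ} (hY : Measurable[𝓕] Y) : Measurable[𝓕] (fun ω => M *ᵥ Y ω) :=
  (Matrix.mulVecLin M).toContinuousLinearMap.continuous.measurable.comp hY

theorem memLp_mulVec_add {p q r : ℕ} (A : Matrix (Fin p) (Fin q) ℝ) (B : Matrix (Fin p) (Fin r) ℝ)
    {Y : Ω → Fin q → ℝ} {Z : Ω → Fin r → ℝ} (hY : MemLp Y 2 μ) (hZ : MemLp Z 2 μ) :
    MemLp (fun ω => A *ᵥ Y ω + B *ᵥ Z ω) 2 μ :=
  (memLp_mulVec A hY).add (memLp_mulVec B hZ)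

theorem measurable_mulVec_add {p q r : ℕ} (A : Matrix (Fin p) (Fin q) ℝ)
    (B : Matrix (Fin p) (Fin r) ℝ) {𝓕 : MeasurableSpace Ω} {Y : Ω → Fin q → ℝ}
    {Z : Ω → Fin r → ℝ} (hY : Measurable[𝓕] Y) (hZ : Measurable[𝓕] Z) :
    Measurable[𝓕] (fun ω => A *ᵥ Y ω + B *ᵥ Z ω) :=
  (measurable_mulVec A hY).add (measurable_mulVec B hZ)

theorem integrable_dotProduct_mulVec (M : Matrix (Fin p) (Fin q) ℝ) {Y : Ω → Fin p → ℝ}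
    {Z : Ω → Fin q → ℝ} (hY : MemLp Y 2 μ) (hZ : MemLp Z 2 μ) :
    Integrable (fun ω => Y ω ⬝ᵥ (M *ᵥ Z ω)) μ := by
  simp only [dotProduct]
  exact integrable_finsetSum _ fun i _ =>
    (hY.eval i).integrable_mul ((memLp_mulVec M hZ).eval i)

theorem ip_congr {M : Matrix (Fin p) (Fin q) ℝ} {Y Y' : Ω → Fin p → ℝ} {Z Z' : Ω → Fin q → ℝ}
    (hY : Y =ᵐ[μ] Y') (hZ : Z =ᵐ[μ] Z') : ip μ M Y Z = ip μ M Y' Z' := by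
  refine integral_congr_ae ?_
  filter_upwards [hY, hZ] with ω h1 h2
  rw [h1, h2]

theorem ip_add_left (M : Matrix (Fin p) (Fin q) ℝ) {Y Y' : Ω → Fin p → ℝ} {Z : Ω → Fin q → ℝ}
    (hY : MemLp Y 2 μ) (hY' : MemLp Y' 2 μ) (hZ : MemLp Z 2 μ) :
    ip μ M (fun ω => Y ω + Y' ω) Z = ip μ M Y Z + ip μ M Y' Z := by
  simp only [ip, add_dotProduct]
  exact integral_add (integrable_dotProduct_mulVec M hY hZ) (integrable_dotProduct_mulVec M hY' hZ)

theorem ip_transpose (M : Matrix (Fin p) (Fin q) ℝ) (Y : Ω → Fin p → ℝ) (Z : Ω → Fin q → ℝ) :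
    ip μ Mᵀ Z Y = ip μ M Y Z := by
  simp only [ip]
  congr 1; ext ω
  rw [mulVec_transpose, dotProduct_comm, ← dotProduct_mulVec]

theorem ip_add_right (M : Matrix (Fin p) (Fin q) ℝ) {Y : Ω → Fin p → ℝ} {Z Z' : Ω → Fin q → ℝ}
    (hY : MemLp Y 2 μ) (hZ : MemLp Z 2 μ) (hZ' : MemLp Z' 2 μ) :
    ip μ M Y (fun ω => Z ω + Z' ω) = ip μ M Y Z + ip μ M Y Z' := by
  rw [← ip_transpose, ip_add_left _ hZ hZ' hY, ip_transpose, ip_transpose]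

theorem ip_mulVec_mulVec (M : Matrix (Fin p) (Fin q) ℝ) (A : Matrix (Fin p) (Fin r) ℝ)
    (B : Matrix (Fin q) (Fin s) ℝ) (Y : Ω → Fin r → ℝ) (Z : Ω → Fin s → ℝ) :
    ip μ M (fun ω => A *ᵥ Y ω) (fun ω => B *ᵥ Z ω) = ip μ (Aᵀ * M * B) Y Z := by
  simp only [ip]
  congr 1; ext ω
  rw [← mulVec_mulVec, ← mulVec_mulVec, dotProduct_mulVec (Y ω), vecMul_transpose]

theorem ip_mulVec_add_self {p q r : ℕ} {M : Matrix (Fin p) (Fin p) ℝ} (hM : M.IsSymm)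
    (A : Matrix (Fin p) (Fin q) ℝ) (B : Matrix (Fin p) (Fin r) ℝ) {Y : Ω → Fin q → ℝ}
    {Z : Ω → Fin r → ℝ} (hY : MemLp Y 2 μ) (hZ : MemLp Z 2 μ) :
    ip μ M (fun ω => A *ᵥ Y ω + B *ᵥ Z ω) (fun ω => A *ᵥ Y ω + B *ᵥ Z ω)
      = ip μ (Aᵀ * M * A) Y Y + 2 * ip μ (Bᵀ * M * A) Z Y + ip μ (Bᵀ * M * B) Z Z := by
  have hA := memLp_mulVec A hY
  have hB := memLp_mulVec B hZ
  have e : Aᵀ * M * B = (Bᵀ * M * A)ᵀ := by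
    rw [transpose_mul, transpose_mul, transpose_transpose, hM, Matrix.mul_assoc]
  rw [ip_add_left M hA hB (memLp_mulVec_add A B hY hZ), ip_add_right M hA hA hB,
    ip_add_right M hB hA hB]
  simp only [ip_mulVec_mulVec]
  rw [e, ip_transpose]
  ring

theorem ip_matrix_add (M M' : Matrix (Fin p) (Fin q) ℝ) {Y : Ω → Fin p → ℝ} {Z : Ω → Fin q → ℝ}
    (hY : MemLp Y 2 μ) (hZ : MemLp Z 2 μ) : ip μ (M + M') Y Z = ip μ M Y Z + ip μ M' Y Z := by
  simp only [ip, add_mulVec, dotProduct_add]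
  exact integral_add (integrable_dotProduct_mulVec M hY hZ) (integrable_dotProduct_mulVec M' hY hZ)

theorem ip_matrix_neg (M : Matrix (Fin p) (Fin q) ℝ) (Y : Ω → Fin p → ℝ) (Z : Ω → Fin q → ℝ) :
    ip μ (-M) Y Z = -ip μ M Y Z := by
  simp only [ip, neg_mulVec, dotProduct_neg, integral_neg]

theorem ip_matrix_sub (M M' : Matrix (Fin p) (Fin q) ℝ) {Y : Ω → Fin p → ℝ} {Z : Ω → Fin q → ℝ}
    (hY : MemLp Y 2 μ) (hZ : MemLp Z 2 μ) : ip μ (M - M') Y Z = ip μ M Y Z - ip μ M' Y Z := by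
  rw [sub_eq_add_neg, ip_matrix_add _ _ hY hZ, ip_matrix_neg, sub_eq_add_neg]

theorem ip_matrix_zero (Y : Ω → Fin p → ℝ) (Z : Ω → Fin q → ℝ) :
    ip μ (0 : Matrix (Fin p) (Fin q) ℝ) Y Z = 0 := by
  simp [ip]

theorem ip_matrix_sum {ι : Type*} (I : Finset ι) (M : ι → Matrix (Fin p) (Fin q) ℝ)
    {Y : Ω → Fin p → ℝ} {Z : Ω → Fin q → ℝ} (hY : MemLp Y 2 μ) (hZ : MemLp Z 2 μ) :
    ip μ (∑ i ∈ I, M i) Y Z = ∑ i ∈ I, ip μ (M i) Y Z := by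
  classical
  induction I using Finset.induction_on with
  | empty => simp [ip_matrix_zero]
  | insert a I ha ih => rw [Finset.sum_insert ha, Finset.sum_insert ha, ip_matrix_add _ _ hY hZ, ih]

/-- A factor known to `𝓕` passes inside the conditional expectation, which integration then removes.
-/
theorem ip_condExp_right [IsFiniteMeasure μ] (M : Matrix (Fin p) (Fin q) ℝ)
    {𝓕 : MeasurableSpace Ω} (h𝓕 : 𝓕 ≤ m0) {Y : Ω → Fin p → ℝ} {Z : Ω → Fin q → ℝ}
    (hYm : Measurable[𝓕] Y) (hY : MemLp Y 2 μ) (hZ : MemLp Z 2 μ) :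
    ip μ M Y (μ[Z | 𝓕]) = ip μ M Y Z := by
  have h := condExp_bilin_of_stronglyMeasurable_left (μ := μ) (bilin M) (f := Y) (g := Z)
    hYm.stronglyMeasurable
    (by simpa only [bilin_apply] using integrable_dotProduct_mulVec M hY hZ)
    (hZ.integrable (by norm_num))
  simp only [bilin_apply] at h
  rw [ip, ip, ← integral_congr_ae h, integral_condExp h𝓕]

theorem condExp_mulVec_add [IsFiniteMeasure μ] (A : Matrix (Fin p) (Fin q) ℝ)
    (B : Matrix (Fin p) (Fin r) ℝ) {𝓕 : MeasurableSpace Ω} (h𝓕 : 𝓕 ≤ m0)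
    {Y : Ω → Fin q → ℝ} {u : Ω → Fin r → ℝ}
    (hY : MemLp Y 2 μ) (hum : Measurable[𝓕] u) (hu : MemLp u 2 μ) :
    μ[fun ω => A *ᵥ Y ω + B *ᵥ u ω | 𝓕] =ᵐ[μ] fun ω => A *ᵥ (μ[Y | 𝓕]) ω + B *ᵥ u ω := by
  have h1 := condExp_add ((memLp_mulVec A hY).integrable (by norm_num))
    ((memLp_mulVec B hu).integrable (by norm_num)) 𝓕
  have h2 := (Matrix.mulVecLin A).toContinuousLinearMap.comp_condExp_comm
    (hY.integrable (μ := μ) (by norm_num)) (m := 𝓕)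
  have h3 : μ[fun ω => B *ᵥ u ω | 𝓕] = fun ω => B *ᵥ u ω :=
    condExp_of_stronglyMeasurable h𝓕 (measurable_mulVec B hum).stronglyMeasurable
      ((memLp_mulVec B hu).integrable (by norm_num))
  rw [h3] at h1
  filter_upwards [h1, h2] with ω e1 e2
  exact e1.trans (congrArg (· + B *ᵥ u ω) e2.symm)

end Pairing

/-! ### Multiplication by a noise variable -/

section Noise

variable {Ω : Type*} {𝓕 m0 : MeasurableSpace Ω} {μ : Measure Ω} [IsFiniteMeasure μ]
  {v : Ω → ℝ} {p q : ℕ}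

/-- The measures v²μ and μ agree on `𝓕`, because v² has conditional mean one. Working with
nonnegative functions avoids assuming that v² f is integrable, which is the point at issue in
`memLp_noise_mul`. -/
theorem lintegral_enorm_mul_sq (h𝓕 : 𝓕 ≤ m0) (hvm : Measurable v) (hv : MemLp v 2 μ)
    (hv2 : μ[fun ω => v ω ^ 2 | 𝓕] =ᵐ[μ] fun _ => 1) {f : Ω → ENNReal} (hf : Measurable[𝓕] f) :
    ∫⁻ ω, ENNReal.ofReal (v ω ^ 2) * f ω ∂μ = ∫⁻ ω, f ω ∂μ := by
  have hg : Measurable fun ω => ENNReal.ofReal (v ω ^ 2) := (hvm.pow_const 2).ennreal_ofReal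
  have htrim : (μ.withDensity fun ω => ENNReal.ofReal (v ω ^ 2)).trim h𝓕 = μ.trim h𝓕 := by
    refine @Measure.ext _ 𝓕 _ _ fun s hs => ?_
    rw [trim_measurableSet_eq h𝓕 hs, trim_measurableSet_eq h𝓕 hs,
      withDensity_apply _ (h𝓕 s hs), ← ofReal_integral_eq_lintegral_ofReal hv.integrable_sq.restrict
        (Filter.Eventually.of_forall fun ω => sq_nonneg _),
      ← setIntegral_condExp h𝓕 hv.integrable_sq hs,
      setIntegral_congr_ae (g := fun _ => 1) (h𝓕 s hs) (hv2.mono fun ω h _ => h)]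
    simp
  have h1 := lintegral_withDensity_eq_lintegral_mul μ hg (hf.mono h𝓕 le_rfl)
  rw [← lintegral_trim h𝓕 hf, htrim, lintegral_trim h𝓕 hf] at h1
  exact h1.symm

theorem memLp_noise_mul (h𝓕 : 𝓕 ≤ m0) (hvm : Measurable v) (hv : MemLp v 2 μ)
    (hv2 : μ[fun ω => v ω ^ 2 | 𝓕] =ᵐ[μ] fun _ => 1) {f : Ω → ℝ} (hfm : Measurable[𝓕] f)
    (hf : MemLp f 2 μ) : MemLp (fun ω => v ω * f ω) 2 μ := by
  have hm : Measurable fun ω => v ω * f ω := hvm.mul (hfm.mono h𝓕 le_rfl)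
  refine (memLp_two_iff_integrable_sq hm.aestronglyMeasurable).2
    ⟨(hm.pow_const 2).aestronglyMeasurable, ?_⟩
  have h := lintegral_enorm_mul_sq h𝓕 hvm hv hv2 (f := fun ω => ENNReal.ofReal (f ω ^ 2))
    (hfm.pow_const 2).ennreal_ofReal
  rw [hasFiniteIntegral_iff_ofReal (Filter.Eventually.of_forall fun ω => sq_nonneg _)]
  have h2 : ∀ ω, ENNReal.ofReal ((v ω * f ω) ^ 2)
      = ENNReal.ofReal (v ω ^ 2) * ENNReal.ofReal (f ω ^ 2) := fun ω => by
    rw [mul_pow, ENNReal.ofReal_mul (sq_nonneg _)]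
  simp only [h2, h]
  exact (hasFiniteIntegral_iff_ofReal (Filter.Eventually.of_forall fun ω => sq_nonneg _)).1
    hf.integrable_sq.2

theorem memLp_noise_smul (h𝓕 : 𝓕 ≤ m0) (hvm : Measurable v) (hv : MemLp v 2 μ)
    (hv2 : μ[fun ω => v ω ^ 2 | 𝓕] =ᵐ[μ] fun _ => 1) {Z : Ω → Fin q → ℝ}
    (hZm : Measurable[𝓕] Z) (hZ : MemLp Z 2 μ) : MemLp (fun ω => v ω • Z ω) 2 μ :=
  MemLp.of_eval fun i => memLp_noise_mul h𝓕 hvm hv hv2 ((measurable_pi_apply i).comp hZm) (hZ.eval i)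

theorem measurable_dotProduct_mulVec (M : Matrix (Fin p) (Fin q) ℝ) {Y : Ω → Fin p → ℝ}
    {Z : Ω → Fin q → ℝ} (hYm : Measurable[𝓕] Y) (hZm : Measurable[𝓕] Z) :
    Measurable[𝓕] fun ω => Y ω ⬝ᵥ (M *ᵥ Z ω) := by
  simp only [dotProduct]
  exact Finset.measurable_sum _ fun i _ => ((measurable_pi_apply i).comp hYm).mul
    ((measurable_pi_apply i).comp (measurable_mulVec M hZm))

theorem ip_noise_smul_smul (h𝓕 : 𝓕 ≤ m0) (hvm : Measurable v) (hv : MemLp v 2 μ)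
    (hv2 : μ[fun ω => v ω ^ 2 | 𝓕] =ᵐ[μ] fun _ => 1) (M : Matrix (Fin p) (Fin q) ℝ)
    {Y : Ω → Fin p → ℝ} {Z : Ω → Fin q → ℝ} (hYm : Measurable[𝓕] Y) (hY : MemLp Y 2 μ)
    (hZm : Measurable[𝓕] Z) (hZ : MemLp Z 2 μ) :
    ip μ M (fun ω => v ω • Y ω) (fun ω => v ω • Z ω) = ip μ M Y Z := by
  have hint := integrable_dotProduct_mulVec M (memLp_noise_smul h𝓕 hvm hv hv2 hYm hY)
    (memLp_noise_smul h𝓕 hvm hv hv2 hZm hZ)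
  have e : (fun ω => (v ω • Y ω) ⬝ᵥ (M *ᵥ (v ω • Z ω)))
      = (fun ω => Y ω ⬝ᵥ (M *ᵥ Z ω)) * fun ω => v ω ^ 2 := by
    ext ω
    simp only [mulVec_smul, smul_dotProduct, dotProduct_smul, smul_eq_mul, Pi.mul_apply]
    ring
  rw [e] at hint
  have h := condExp_mul_of_stronglyMeasurable_left
    (measurable_dotProduct_mulVec M hYm hZm).stronglyMeasurable hint hv.integrable_sq
  rw [ip, ip, e, ← integral_condExp h𝓕, integral_congr_ae h]
  refine integral_congr_ae ?_
  filter_upwards [hv2] with ω hω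
  simp [hω]

theorem ip_noise_smul_right (h𝓕 : 𝓕 ≤ m0) (hvm : Measurable v) (hv : MemLp v 2 μ)
    (hv1 : μ[v | 𝓕] =ᵐ[μ] fun _ => 0)
    (hv2 : μ[fun ω => v ω ^ 2 | 𝓕] =ᵐ[μ] fun _ => 1) (M : Matrix (Fin p) (Fin q) ℝ)
    {Y : Ω → Fin p → ℝ} {Z : Ω → Fin q → ℝ} (hYm : Measurable[𝓕] Y) (hY : MemLp Y 2 μ)
    (hZm : Measurable[𝓕] Z) (hZ : MemLp Z 2 μ) :
    ip μ M Y (fun ω => v ω • Z ω) = 0 := by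
  have hint := integrable_dotProduct_mulVec M hY (memLp_noise_smul h𝓕 hvm hv hv2 hZm hZ)
  have e : (fun ω => Y ω ⬝ᵥ (M *ᵥ (v ω • Z ω))) = (fun ω => Y ω ⬝ᵥ (M *ᵥ Z ω)) * v := by
    ext ω
    simp only [mulVec_smul, dotProduct_smul, smul_eq_mul, Pi.mul_apply]
    ring
  rw [e] at hint
  have h := condExp_mul_of_stronglyMeasurable_left
    (measurable_dotProduct_mulVec M hYm hZm).stronglyMeasurable hint
    (hv.integrable (by norm_num))
  rw [ip, e, ← integral_condExp h𝓕, integral_congr_ae h, ← integral_zero Ω ℝ (μ := μ)]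
  refine integral_congr_ae ?_
  filter_upwards [hv1] with ω hω
  simp [hω]

/-- The cross terms vanish because the noise has conditional mean zero, and its conditional second
moment one leaves the form at `Z` unweighted. -/
theorem ip_add_noise_smul (h𝓕 : 𝓕 ≤ m0) (hvm : Measurable v) (hv : MemLp v 2 μ)
    (hv1 : μ[v | 𝓕] =ᵐ[μ] fun _ => 0)
    (hv2 : μ[fun ω => v ω ^ 2 | 𝓕] =ᵐ[μ] fun _ => 1) (M : Matrix (Fin p) (Fin p) ℝ)
    {Y Z : Ω → Fin p → ℝ} (hYm : Measurable[𝓕] Y) (hY : MemLp Y 2 μ)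
    (hZm : Measurable[𝓕] Z) (hZ : MemLp Z 2 μ) :
    ip μ M (fun ω => Y ω + v ω • Z ω) (fun ω => Y ω + v ω • Z ω) = ip μ M Y Y + ip μ M Z Z := by
  have hw := memLp_noise_smul h𝓕 hvm hv hv2 hZm hZ
  have hYw : MemLp (fun ω => Y ω + v ω • Z ω) 2 μ := hY.add hw
  rw [ip_add_left M hY hw hYw, ip_add_right M hY hY hw, ip_add_right M hw hY hw,
    ip_noise_smul_smul h𝓕 hvm hv hv2 M hZm hZ hZm hZ,
    ip_noise_smul_right h𝓕 hvm hv hv1 hv2 M hYm hY hZm hZ, ← ip_transpose M (fun ω => v ω • Z ω) Y,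
    ip_noise_smul_right h𝓕 hvm hv hv1 hv2 Mᵀ hYm hY hZm hZ]
  ring

/-- The noise does not contribute to conditional expectations given the past. -/
theorem condExp_noise_smul (h𝓕 : 𝓕 ≤ m0) (hvm : Measurable v) (hv : MemLp v 2 μ)
    (hv1 : μ[v | 𝓕] =ᵐ[μ] fun _ => 0)
    (hv2 : μ[fun ω => v ω ^ 2 | 𝓕] =ᵐ[μ] fun _ => 1) {Z : Ω → Fin p → ℝ}
    (hZm : Measurable[𝓕] Z) (hZ : MemLp Z 2 μ) :
    μ[fun ω => v ω • Z ω | 𝓕] =ᵐ[μ] fun _ => 0 := by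
  have hw := (memLp_noise_smul h𝓕 hvm hv hv2 hZm hZ).integrable (by norm_num)
  have h := condExp_smul_of_aestronglyMeasurable_right (m := 𝓕) (hv.integrable (by norm_num)) hw
    hZm.stronglyMeasurable.aestronglyMeasurable
  refine h.trans ?_
  filter_upwards [hv1] with ω hω
  simp [hω]

end Noise

/-! ### Moore-Penrose inverses and definite matrices -/

section LinearAlgebra

variable {p q : ℕ}

theorem IsMoorePenrose.transpose {M : Matrix (Fin p) (Fin q) ℝ} {X : Matrix (Fin q) (Fin p) ℝ}
    (h : IsMoorePenrose M X) : IsMoorePenrose Mᵀ Xᵀ where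
  mul_mul_self := by rw [← transpose_mul, ← transpose_mul, ← Matrix.mul_assoc, h.mul_mul_self]
  mul_mul_inv := by rw [← transpose_mul, ← transpose_mul, ← Matrix.mul_assoc, h.mul_mul_inv]
  symm_left := by rw [← transpose_mul, h.symm_right, h.symm_right]
  symm_right := by rw [← transpose_mul, h.symm_left, h.symm_left]

/-- Transposition preserves the Penrose equations, and their solution is unique. This keeps the
recursion symmetric even where `W` is not yet known to be invertible. -/
theorem isSymm_pinv {M : Matrix (Fin p) (Fin p) ℝ} (hM : M.IsSymm) : (pinv M).IsSymm := by
  have h := (pinv_spec M).transpose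
  rw [hM] at h
  exact h.unique (pinv_spec M)

theorem pinv_eq_inv {M : Matrix (Fin p) (Fin p) ℝ} (hM : IsUnit M.det) : pinv M = M⁻¹ := by
  refine (pinv_spec M).unique ⟨?_, ?_, ?_, ?_⟩ <;>
    simp [mul_nonsing_inv _ hM, nonsing_inv_mul _ hM]

theorem isSymm_transpose_mul_mul {M : Matrix (Fin p) (Fin p) ℝ} (hM : M.IsSymm)
    (A : Matrix (Fin p) (Fin q) ℝ) : (Aᵀ * M * A).IsSymm := by
  rw [Matrix.IsSymm, transpose_mul, transpose_mul, transpose_transpose, hM, Matrix.mul_assoc]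

theorem isSymm_sum {ι : Type*} {M : ι → Matrix (Fin p) (Fin p) ℝ} {I : Finset ι}
    (hM : ∀ i ∈ I, (M i).IsSymm) : (∑ i ∈ I, M i).IsSymm := by
  rw [Matrix.IsSymm, transpose_sum]
  exact Finset.sum_congr rfl hM

theorem posDef_of_isSymm {M : Matrix (Fin p) (Fin p) ℝ} (hM : M.IsSymm)
    (h : ∀ y : Fin p → ℝ, y ≠ 0 → 0 < y ⬝ᵥ (M *ᵥ y)) : M.PosDef := by
  refine PosDef.of_dotProduct_mulVec_pos ?_ fun y hy => by simpa using h y hy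
  rw [Matrix.IsHermitian, conjTranspose_eq_transpose_of_trivial]
  exact hM

theorem dotProduct_mulVec_pos {M : Matrix (Fin p) (Fin p) ℝ} (hM : M.PosDef) {y : Fin p → ℝ}
    (hy : y ≠ 0) : 0 < y ⬝ᵥ (M *ᵥ y) := by
  simpa using hM.dotProduct_mulVec_pos hy

theorem dotProduct_mulVec_nonneg {M : Matrix (Fin p) (Fin p) ℝ} (hM : M.PosDef) (y : Fin p → ℝ) :
    0 ≤ y ⬝ᵥ (M *ᵥ y) := by
  simpa using hM.posSemidef.dotProduct_mulVec_nonneg y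

theorem dotProduct_le_norm_sq (y : Fin p → ℝ) : y ⬝ᵥ y ≤ p * ‖y‖ ^ 2 := by
  have h : ∀ i ∈ Finset.univ, y i * y i ≤ ‖y‖ ^ 2 := fun i _ => by
    have := norm_le_pi_norm y i
    calc y i * y i = ‖y i‖ ^ 2 := by rw [Real.norm_eq_abs, sq_abs, sq]
      _ ≤ ‖y‖ ^ 2 := by gcongr
  simpa [dotProduct] using Finset.sum_le_card_nsmul Finset.univ (fun i => y i * y i) _ h

theorem continuous_dotProduct_mulVec (M : Matrix (Fin p) (Fin p) ℝ) :
    Continuous fun y : Fin p → ℝ => y ⬝ᵥ (M *ᵥ y) := by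
  fun_prop

/-- A positive definite form is bounded below by a multiple of the standard one. -/
theorem exists_pos_mul_le_of_posDef {M : Matrix (Fin p) (Fin p) ℝ} (hM : M.PosDef) :
    ∃ c : ℝ, 0 < c ∧ ∀ y : Fin p → ℝ, c * (y ⬝ᵥ y) ≤ y ⬝ᵥ (M *ᵥ y) := by
  obtain ⟨c, hc, h⟩ : ∃ c : ℝ, 0 < c ∧ ∀ y ∈ Metric.sphere (0 : Fin p → ℝ) 1,
      c ≤ y ⬝ᵥ (M *ᵥ y) := by
    rcases (Metric.sphere (0 : Fin p → ℝ) 1).eq_empty_or_nonempty with he | hne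
    · exact ⟨1, one_pos, by simp [he]⟩
    · obtain ⟨z, hz, hmin⟩ := (isCompact_sphere (0 : Fin p → ℝ) 1).exists_isMinOn hne
        (continuous_dotProduct_mulVec M).continuousOn
      refine ⟨_, dotProduct_mulVec_pos hM (y := z) ?_, fun y hy => hmin hy⟩
      rintro rfl
      simp at hz
  -- The sphere is that of the sup norm, and y ⬝ᵥ y ≤ p ‖y‖²; the added 1 keeps the denominator
  -- positive for p = 0.
  refine ⟨c / (p + 1), by positivity, fun y => ?_⟩
  rcases eq_or_ne y 0 with rfl | hy
  · simp
  have hn : 0 < ‖y‖ := norm_pos_iff.2 hy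
  have h1 := h (‖y‖⁻¹ • y) (by simp [norm_smul, hn.ne'])
  rw [mulVec_smul, smul_dotProduct, dotProduct_smul, smul_eq_mul, smul_eq_mul, ← mul_assoc] at h1
  have h2 : c * ‖y‖ ^ 2 ≤ y ⬝ᵥ (M *ᵥ y) := by
    calc c * ‖y‖ ^ 2 ≤ (‖y‖⁻¹ * ‖y‖⁻¹ * (y ⬝ᵥ (M *ᵥ y))) * ‖y‖ ^ 2 := by gcongr
      _ = _ := by field_simp
  have h3 := dotProduct_le_norm_sq y
  calc c / (p + 1) * (y ⬝ᵥ y) ≤ c / (p + 1) * ((p + 1) * ‖y‖ ^ 2) := by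
        gcongr; nlinarith [sq_nonneg ‖y‖]
    _ = c * ‖y‖ ^ 2 := by field_simp
    _ ≤ _ := h2

end LinearAlgebra

/-! ### The backward recursion -/

section Recursion

variable {n m : ℕ} {S : LQData n m} {N d t : ℕ}

/-- Only the indices up to min d (k + 1 - t) enter, which are the ones that the equations determine
at time k + 1. -/
theorem W_congr {P P' : ℕ → ℕ → Matrix (Fin n) (Fin n) ℝ} {k : ℕ}
    (h : ∀ i ≤ min d (k + 1 - t), P i (k + 1) = P' i (k + 1)) : W S d t P k = W S d t P' k := by
  rw [W, W, h 0 (Nat.zero_le _)]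
  congr 2
  exact Finset.sum_congr rfl fun i hi => by rw [h i (by simpa [Nat.lt_succ_iff] using hi)]

theorem H_congr {P P' : ℕ → ℕ → Matrix (Fin n) (Fin n) ℝ} {k : ℕ}
    (h : ∀ i ≤ min d (k + 1 - t), P i (k + 1) = P' i (k + 1)) : H S d t P k = H S d t P' k := by
  rw [H, H, h 0 (Nat.zero_le _)]
  congr 1
  exact Finset.sum_congr rfl fun i hi => by rw [h i (by simpa [Nat.lt_succ_iff] using hi)]

/-- The quadratic correction `Hᵀ W† H` at time `k`. -/
noncomputable def correction (S : LQData n m) (d t : ℕ) (P : ℕ → ℕ → Matrix (Fin n) (Fin n) ℝ)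
    (k : ℕ) : Matrix (Fin n) (Fin n) ℝ :=
  (H S d t P k)ᵀ * pinv (W S d t P k) * H S d t P k

/-- One backward step: the matrices at time `k` from those at time `k + 1`. -/
noncomputable def riccatiStep (S : LQData n m) (d t k : ℕ) (F : ℕ → Matrix (Fin n) (Fin n) ℝ)
    (i : ℕ) : Matrix (Fin n) (Fin n) ℝ :=
  (if i = 0 then S.Q k + (S.A k)ᵀ * (F 0 + F 1) * S.A k + (S.C k)ᵀ * F 0 * S.C k
    else if i < d then (S.A k)ᵀ * F (i + 1) * S.A k else 0)
  - if i = min d (k - t) then correction S d t (fun i _ => F i) k else 0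

/-- The matrices `P^{(i)}_{N-j}` of the backward recursion. -/
noncomputable def riccatiBackward (S : LQData n m) (N d t : ℕ) :
    ℕ → ℕ → Matrix (Fin n) (Fin n) ℝ
  | 0 => fun i => if i = 0 then S.G else 0
  | j + 1 => riccatiStep S d t (N - 1 - j) (riccatiBackward S N d t j)

/-- The matrices `P^{(i)}_k` produced by the backward recursion, without the constraints. -/
noncomputable def riccati (S : LQData n m) (N d t : ℕ) (i k : ℕ) : Matrix (Fin n) (Fin n) ℝ :=
  riccatiBackward S N d t (N - k) i

theorem riccati_terminal (i : ℕ) : riccati S N d t i N = if i = 0 then S.G else 0 := by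
  simp [riccati, riccatiBackward]

theorem riccati_eq_step {k : ℕ} (hk : k < N) (i : ℕ) :
    riccati S N d t i k = riccatiStep S d t k (fun i => riccati S N d t i (k + 1)) i := by
  obtain ⟨j, rfl⟩ : ∃ j, N = k + 1 + j := ⟨N - (k + 1), by omega⟩
  have h1 : k + 1 + j - k = j + 1 := by omega
  have h2 : k + 1 + j - 1 - j = k := by omega
  have h3 : k + 1 + j - (k + 1) = j := by omega
  simp only [riccati, h1, h3, riccatiBackward, h2]

/-- The correction sits at the oldest index in use, min d (k - t): this is 0 at k = t, k - t before
t + d, and d from then on. One formula thus covers all cases of the equations; indices beyond the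
oldest carry irrelevant values. -/
theorem riccati_eq {k : ℕ} (hk : k < N) (i : ℕ) :
    riccati S N d t i k =
      (if i = 0 then S.Q k + (S.A k)ᵀ * (riccati S N d t 0 (k + 1) + riccati S N d t 1 (k + 1))
          * S.A k + (S.C k)ᵀ * riccati S N d t 0 (k + 1) * S.C k
        else if i < d then (S.A k)ᵀ * riccati S N d t (i + 1) (k + 1) * S.A k else 0)
      - if i = min d (k - t) then correction S d t (riccati S N d t) k else 0 :=
  riccati_eq_step hk i

theorem isSymm_W {P : ℕ → ℕ → Matrix (Fin n) (Fin n) ℝ} {k : ℕ} (hR : (S.R k).IsSymm)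
    (hP : ∀ i, (P i (k + 1)).IsSymm) : (W S d t P k).IsSymm :=
  (hR.add (isSymm_sum fun i _ => isSymm_transpose_mul_mul (hP i) _)).add
    (isSymm_transpose_mul_mul (hP 0) _)

theorem isSymm_correction {P : ℕ → ℕ → Matrix (Fin n) (Fin n) ℝ} {k : ℕ} (hR : (S.R k).IsSymm)
    (hP : ∀ i, (P i (k + 1)).IsSymm) : (correction S d t P k).IsSymm :=
  isSymm_transpose_mul_mul (isSymm_pinv (isSymm_W hR hP)) _

theorem isSymm_riccati (hQ : ∀ k, t ≤ k → k < N → (S.Q k).IsSymm)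
    (hR : ∀ k, t ≤ k → k < N → (S.R k).IsSymm) (hG : S.G.IsSymm) {k : ℕ} (hkN : k ≤ N)
    (htk : t ≤ k) (i : ℕ) : (riccati S N d t i k).IsSymm := by
  induction hkN using Nat.decreasingInduction generalizing i with
  | self =>
    rw [riccati_terminal]
    split_ifs
    · exact hG
    · exact isSymm_zero
  | of_succ k hk ih =>
    have ih := ih (by omega)
    rw [riccati_eq hk]
    refine IsSymm.sub ?_ ?_
    · split_ifs
      · exact ((hQ k htk hk).add (isSymm_transpose_mul_mul ((ih 0).add (ih 1)) _)).add
          (isSymm_transpose_mul_mul (ih 0) _)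
      · exact isSymm_transpose_mul_mul (ih _) _
      · exact isSymm_zero
    · split_ifs
      · exact isSymm_correction (hR k htk hk) ih
      · exact isSymm_zero

/-- The relevant part of a solution of the Riccati-like equations is unique. -/
theorem IsRiccatiSolution.eq_riccati (hd : 2 ≤ d) {P : ℕ → ℕ → Matrix (Fin n) (Fin n) ℝ}
    (hP : IsRiccatiSolution S N d t P) {k : ℕ} (hkN : k ≤ N) (htk : t ≤ k) {i : ℕ}
    (hi : i ≤ min d (k - t)) : P i k = riccati S N d t i k := by
  induction hkN using Nat.decreasingInduction generalizing i with
  | self =>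
    rw [riccati_terminal]
    split_ifs with h
    · rw [h, hP.terminal_zero]
    · exact hP.terminal i (by omega) (by omega)
  | of_succ k hk ih =>
    have ih : ∀ i ≤ min d (k + 1 - t), P i (k + 1) = riccati S N d t i (k + 1) :=
      fun i hi => ih (by omega) hi
    have hc : (H S d t P k)ᵀ * pinv (W S d t P k) * H S d t P k
        = correction S d t (riccati S N d t) k := by
      rw [correction, W_congr ih, H_congr ih]
    rw [riccati_eq hk, ← hc, ← ih 0 (by omega), ← ih 1 (by omega)]
    rcases Nat.eq_zero_or_pos i with rfl | hi0
    · rw [if_pos rfl]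
      rcases htk.eq_or_lt with rfl | htk
      · rw [if_pos (by omega), hP.initial]
      · rw [if_neg (by omega), sub_zero, hP.zero k htk hk]
    · rw [if_neg (by omega)]
      rcases lt_or_ge k (t + d) with hkd | hkd
      · rw [if_pos (show i < d by omega), ← ih (i + 1) (by omega)]
        rcases (show i ≤ k - t by omega).eq_or_lt with rfl | hik
        · rw [if_pos (by omega), hP.early_last k (by omega) hkd hk,
            show k + 1 - t = k - t + 1 by omega]
        · rw [if_neg (by omega), sub_zero, hP.early_linear k (by omega) hkd hk i hi0 hik]
      · rcases (show i ≤ d by omega).eq_or_lt with rfl | hid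
        · rw [if_neg (by omega), if_pos (by omega), zero_sub, hP.late_last k hkd hk]
        · rw [if_pos hid, if_neg (by omega), sub_zero, ← ih (i + 1) (by omega),
            hP.late_linear k hkd hk i hi0 (by omega)]

theorem IsRiccatiSolution.W_eq (hd : 2 ≤ d) {P : ℕ → ℕ → Matrix (Fin n) (Fin n) ℝ}
    (hP : IsRiccatiSolution S N d t P) {k : ℕ} (htk : t ≤ k) (hkN : k < N) :
    W S d t P k = W S d t (riccati S N d t) k :=
  W_congr fun _ hi => hP.eq_riccati hd hkN (by omega) hi

theorem IsRiccatiSolution.H_eq (hd : 2 ≤ d) {P : ℕ → ℕ → Matrix (Fin n) (Fin n) ℝ}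
    (hP : IsRiccatiSolution S N d t P) {k : ℕ} (htk : t ≤ k) (hkN : k < N) :
    H S d t P k = H S d t (riccati S N d t) k :=
  H_congr fun _ hi => hP.eq_riccati hd hkN (by omega) hi

theorem isUnit_det_of_posDef {M : Matrix (Fin m) (Fin m) ℝ} (hM : M.PosDef) : IsUnit M.det :=
  hM.det_pos.ne'.isUnit

/-- The equations hold by construction; definiteness turns W† into an inverse, which gives the range
constraint. -/
theorem isRiccatiSolution_riccati (hd : 2 ≤ d) (ht : t < N)
    (hW : ∀ k, t ≤ k → k < N → (W S d t (riccati S N d t) k).PosDef) :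
    IsRiccatiSolution S N d t (riccati S N d t) where
  terminal_zero := by simp [riccati_terminal]
  terminal j h1 _ := by rw [riccati_terminal, if_neg (by omega)]
  zero k h1 h2 := by rw [riccati_eq h2, if_pos rfl, if_neg (by omega), sub_zero]
  late_linear k h1 h2 i h3 h4 := by
    rw [riccati_eq h2, if_neg (by omega), if_pos (by omega), if_neg (by omega), sub_zero]
  late_last k h1 h2 := by
    rw [riccati_eq h2, if_neg (by omega), if_neg (by omega), if_pos (by omega), zero_sub,
      correction]
  early_linear k h1 h2 h3 i h4 h5 := by
    rw [riccati_eq h3, if_neg (by omega), if_pos (by omega), if_neg (by omega), sub_zero]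
  early_last k h1 h2 h3 := by
    rw [riccati_eq h3, if_neg (by omega), if_pos (by omega), if_pos (by omega), correction,
      show k + 1 - t = k - t + 1 by omega]
  initial := by rw [riccati_eq ht, if_pos rfl, if_pos (by omega), correction]
  range_constraint k h1 h2 := by
    rw [pinv_eq_inv (isUnit_det_of_posDef (hW k h1 h2)),
      mul_nonsing_inv _ (isUnit_det_of_posDef (hW k h1 h2)), Matrix.one_mul]
  posSemidef k h1 h2 := (hW k h1 h2).posSemidef

end Recursion

/-! ### Trajectories and the value of the problem -/

section Information

variable {Ω : Type*} {w : ℕ → Ω → ℝ} {d t : ℕ}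

theorem history_mono {k l : ℕ} (h : k ≤ l) : history w k ≤ history w l :=
  iSup_mono fun _ => iSup_mono' fun hj => ⟨lt_of_lt_of_le hj h, le_rfl⟩

theorem info_le_history {l : ℕ} (h : t ≤ l) : info w d t l ≤ history w l :=
  history_mono (by omega)

theorem measurable_noise (l : ℕ) : Measurable[history w (l + 1)] (w l) :=
  measurable_iff_comap_le.2 (le_iSup₂_of_le l (Nat.lt_succ_self l) le_rfl)

variable [m0 : MeasurableSpace Ω] {μ : Measure Ω} {N : ℕ}

theorem IsNoise.history_le (hw : IsNoise μ N w) {k : ℕ} (hk : k ≤ N) : history w k ≤ m0 :=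
  iSup₂_le fun l hl => measurable_iff_comap_le.1 (hw.measurable l (by omega))

theorem IsNoise.info_le (hw : IsNoise μ N w) {l : ℕ} (htl : t ≤ l) (hl : l ≤ N) :
    info w d t l ≤ m0 :=
  (info_le_history htl).trans (hw.history_le hl)

end Information

/-! ### The value function and its one-step identities -/

section Value

variable {Ω : Type*} {𝓖 : MeasurableSpace Ω} [m0 : MeasurableSpace Ω] {μ : Measure Ω}
  {w : ℕ → Ω → ℝ} {n m N d t : ℕ} {S : LQData n m}

/-- The state after one step from the state `X` with the control `u`. -/
def next (S : LQData n m) (w : ℕ → Ω → ℝ) (l : ℕ) (X : Ω → Fin n → ℝ) (u : Ω → Fin m → ℝ) :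
    Ω → Fin n → ℝ :=
  fun ω => (S.A l *ᵥ X ω + S.B l *ᵥ u ω) + w l ω • (S.C l *ᵥ X ω + S.D l *ᵥ u ω)

/-- A square integrable state which is known at time `l`. -/
structure IsState (μ : Measure Ω) (w : ℕ → Ω → ℝ) (l : ℕ) (X : Ω → Fin n → ℝ) : Prop where
  measurable : Measurable[history w l] X
  memLp : MemLp X 2 μ

/-- A square integrable control which depends on the information at time `l`. -/
structure IsControl (μ : Measure Ω) (w : ℕ → Ω → ℝ) (d t l : ℕ) (u : Ω → Fin m → ℝ) : Prop where
  measurable : Measurable[info w d t l] u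
  memLp : MemLp u 2 μ

variable {l : ℕ} {X : Ω → Fin n → ℝ} {u : Ω → Fin m → ℝ}

theorem IsControl.measurable_history (hu : IsControl μ w d t l u) (htl : t ≤ l) :
    Measurable[history w l] u := hu.measurable.mono (info_le_history htl) le_rfl

theorem IsState.memLp_condExp (hX : IsState μ w l X) :
    MemLp (μ[X | 𝓖]) 2 μ := hX.memLp.condExp (by norm_num)

/-- The gain matrix `W_l⁻¹ H_l`. -/
noncomputable def gain (S : LQData n m) (N d t l : ℕ) : Matrix (Fin m) (Fin n) ℝ :=
  (W S d t (riccati S N d t) l)⁻¹ * H S d t (riccati S N d t) l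

/-- The deviation of the control `u` at the state `X` from the feedback control. -/
noncomputable def deviation (μ : Measure Ω) (S : LQData n m) (N d t : ℕ) (w : ℕ → Ω → ℝ) (l : ℕ)
    (X : Ω → Fin n → ℝ) (u : Ω → Fin m → ℝ) : Ω → Fin m → ℝ :=
  fun ω => gain S N d t l *ᵥ (μ[X | info w d t l]) ω + u ω

theorem memLp_deviation (hX : IsState μ w l X) (hu : IsControl μ w d t l u) :
    MemLp (deviation μ S N d t w l X u) 2 μ :=
  (memLp_mulVec _ (hX.memLp_condExp)).add hu.memLp

variable [IsProbabilityMeasure μ]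

theorem IsState.next (hw : IsNoise μ N w) (htl : t ≤ l) (hl : l < N) (hX : IsState μ w l X)
    (hu : IsControl μ w d t l u) : IsState μ w (l + 1) (next S w l X u) := by
  have hum := hu.measurable_history htl
  have h1 := measurable_mulVec_add (S.A l) (S.B l) hX.measurable hum
  have h2 := measurable_mulVec_add (S.C l) (S.D l) hX.measurable hum
  have hle := history_mono (w := w) (Nat.le_succ l)
  refine ⟨(h1.mono hle le_rfl).add ((measurable_noise l).smul (h2.mono hle le_rfl)), ?_⟩
  exact (memLp_mulVec_add _ _ hX.memLp hu.memLp).add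
    (memLp_noise_smul (hw.history_le hl.le) (hw.measurable l hl) (hw.memLp l hl)
      (hw.condExp_sq_eq_one l hl) h2 (memLp_mulVec_add _ _ hX.memLp hu.memLp))

/-- The conditional expectation of the next state given a σ-algebra between the information at
time `l` and the past. -/
theorem condExp_next (hw : IsNoise μ N w) (htl : t ≤ l) (hl : l < N) (hX : IsState μ w l X)
    (hu : IsControl μ w d t l u) (h1 : info w d t l ≤ 𝓖)
    (h2 : 𝓖 ≤ history w l) :
    μ[next S w l X u | 𝓖] =ᵐ[μ] fun ω => S.A l *ᵥ (μ[X | 𝓖]) ω + S.B l *ᵥ u ω := by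
  have hF := hw.history_le hl.le
  have hm := measurable_mulVec_add (S.C l) (S.D l) hX.measurable (hu.measurable_history htl)
  have hL := memLp_mulVec_add (S.C l) (S.D l) hX.memLp hu.memLp
  have e1 := condExp_mulVec_add (S.A l) (S.B l) (h2.trans hF) hX.memLp
    (hu.measurable.mono h1 le_rfl) hu.memLp
  have e2 : μ[fun ω => w l ω • (S.C l *ᵥ X ω + S.D l *ᵥ u ω) | 𝓖] =ᵐ[μ] fun _ => 0 := by
    -- Tower property: conditioning first on the whole past at time l already kills the noise term.
    refine (condExp_condExp_of_le h2 hF).symm.trans ?_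
    refine (condExp_congr_ae (condExp_noise_smul hF (hw.measurable l hl) (hw.memLp l hl)
      (hw.condExp_eq_zero l hl) (hw.condExp_sq_eq_one l hl) hm hL)).trans ?_
    exact Filter.EventuallyEq.of_eq condExp_zero
  have e3 := condExp_add ((memLp_mulVec_add (S.A l) (S.B l) hX.memLp hu.memLp).integrable
    (by norm_num)) ((memLp_noise_smul hF (hw.measurable l hl) (hw.memLp l hl)
      (hw.condExp_sq_eq_one l hl) hm hL).integrable (by norm_num)) 𝓖
  filter_upwards [e1, e2, e3] with ω a1 a2 a3
  refine a3.trans ?_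
  rw [Pi.add_apply, a1, a2, add_zero]

theorem ip_next (hw : IsNoise μ N w) (htl : t ≤ l) (hl : l < N) (hX : IsState μ w l X)
    (hu : IsControl μ w d t l u) (M : Matrix (Fin n) (Fin n) ℝ) :
    ip μ M (next S w l X u) (next S w l X u)
      = ip μ M (fun ω => S.A l *ᵥ X ω + S.B l *ᵥ u ω) (fun ω => S.A l *ᵥ X ω + S.B l *ᵥ u ω)
        + ip μ M (fun ω => S.C l *ᵥ X ω + S.D l *ᵥ u ω) (fun ω => S.C l *ᵥ X ω + S.D l *ᵥ u ω) :=
  ip_add_noise_smul (hw.history_le hl.le) (hw.measurable l hl) (hw.memLp l hl)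
    (hw.condExp_eq_zero l hl) (hw.condExp_sq_eq_one l hl) M
    (measurable_mulVec_add _ _ hX.measurable (hu.measurable_history htl))
    (memLp_mulVec_add _ _ hX.memLp hu.memLp)
    (measurable_mulVec_add _ _ hX.measurable (hu.measurable_history htl))
    (memLp_mulVec_add _ _ hX.memLp hu.memLp)

/-- The value function: the sum of the forms of `P^{(i)}_l` at the estimates `E[X | F_{l-i}]`. -/
noncomputable def value (μ : Measure Ω) (S : LQData n m) (N d t : ℕ) (w : ℕ → Ω → ℝ) (l : ℕ)
    (X : Ω → Fin n → ℝ) : ℝ :=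
  ∑ i ∈ Finset.range (min d (l - t) + 1),
    ip μ (riccati S N d t i l) (μ[X | history w (l - i)]) (μ[X | history w (l - i)])

theorem condExp_state (hw : IsNoise μ N w) (hX : IsState μ w l X) {k : ℕ}
    (hk : k ≤ N) (hlk : l ≤ k) : μ[X | history w k] = X :=
  condExp_of_stronglyMeasurable (hw.history_le hk)
    (hX.measurable.mono (history_mono hlk) le_rfl).stronglyMeasurable
    (hX.memLp.integrable (by norm_num))

theorem value_terminal (hw : IsNoise μ N w) (hX : IsState μ w N X) :
    value μ S N d t w N X = ip μ S.G X X := by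
  rw [value, Finset.sum_range_succ', Finset.sum_eq_zero, zero_add, riccati_terminal, if_pos rfl,
    Nat.sub_zero, condExp_state hw hX le_rfl le_rfl]
  intro i _
  rw [riccati_terminal, if_neg (Nat.succ_ne_zero i), ip_matrix_zero]

/-- Only the index 0 sees w_l and produces the `C`, `D` term. For i ≥ 1 the conditioning σ-algebra
F_{l+1-i} lies between the controller's information and the past at l, so `condExp_next` applies. -/
theorem value_next (hw : IsNoise μ N w) (htl : t ≤ l) (hl : l < N)
    (hX : IsState μ w l X) (hu : IsControl μ w d t l u) :
    value μ S N d t w (l + 1) (next S w l X u)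
      = ∑ i ∈ Finset.range (min d (l + 1 - t) + 1), ip μ (riccati S N d t i (l + 1))
          (fun ω => S.A l *ᵥ (μ[X | history w (l + 1 - i)]) ω + S.B l *ᵥ u ω)
          (fun ω => S.A l *ᵥ (μ[X | history w (l + 1 - i)]) ω + S.B l *ᵥ u ω)
        + ip μ (riccati S N d t 0 (l + 1)) (fun ω => S.C l *ᵥ X ω + S.D l *ᵥ u ω)
            (fun ω => S.C l *ᵥ X ω + S.D l *ᵥ u ω) := by
  rw [value, Finset.sum_range_succ', Finset.sum_range_succ' _ (min d (l + 1 - t)), Nat.sub_zero,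
    condExp_state hw (hX.next hw htl hl hu) hl le_rfl,
    condExp_state hw hX hl (Nat.le_succ l), ip_next hw htl hl hX hu, add_assoc]
  congr 1
  refine Finset.sum_congr rfl fun i hi => ?_
  rw [Finset.mem_range] at hi
  have h := condExp_next (S := S) hw htl hl hX hu (𝓖 := history w (l + 1 - (i + 1)))
    (history_mono (by omega)) (history_mono (by omega))
  exact ip_congr h h

/-- This is the Riccati recursion tested on the estimates: index i + 1 at time l + 1 feeds index i
at time l. The correction, subtracted in the recursion at the oldest estimate, reappears on the
right. -/
theorem quadratic_eq_value (hw : IsNoise μ N w) (hd : 2 ≤ d) (htl : t ≤ l) (hl : l < N)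
    (hX : IsState μ w l X) :
    ip μ (S.Q l) X X + ip μ ((S.C l)ᵀ * riccati S N d t 0 (l + 1) * S.C l) X X
        + ∑ i ∈ Finset.range (min d (l + 1 - t) + 1),
          ip μ ((S.A l)ᵀ * riccati S N d t i (l + 1) * S.A l) (μ[X | history w (l + 1 - i)])
            (μ[X | history w (l + 1 - i)])
      = value μ S N d t w l X
        + ip μ (correction S d t (riccati S N d t) l) (μ[X | info w d t l])
            (μ[X | info w d t l]) := by
  set P := riccati S N d t with hPdef
  set Y : ℕ → Ω → Fin n → ℝ := fun i => μ[X | history w (l - i)] with hY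
  have hYL : ∀ i, MemLp (Y i) 2 μ := fun i => hX.memLp_condExp
  have hY0 : Y 0 = X := condExp_state hw hX (by omega) (by omega)
  -- The oldest estimate in the value is the one the controller holds.
  have hinfo : info w d t l = history w (l - min d (l - t)) := by
    rw [info]; congr 1; omega
  set h : ℕ → ℝ := fun i => ip μ ((S.A l)ᵀ * P (i + 1) (l + 1) * S.A l) (Y i) (Y i) with hh
  -- Before t + d each step adds one estimate; from t + d on the number stays at d + 1, and index d
  -- receives no linear term.
  have hsum : ∑ j ∈ Finset.range (min d (l + 1 - t)), h j
      = ∑ j ∈ Finset.range (min d (l - t) + 1), if j < d then h j else 0 := by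
    rcases lt_or_ge l (t + d) with hld | hld
    · rw [show min d (l + 1 - t) = min d (l - t) + 1 by omega]
      refine Finset.sum_congr rfl fun j hj => ?_
      rw [Finset.mem_range] at hj
      rw [if_pos (by omega)]
    · rw [show min d (l + 1 - t) = d by omega, show min d (l - t) = d by omega,
        Finset.sum_range_succ, if_neg (lt_irrefl d), add_zero]
      exact Finset.sum_congr rfl fun j hj => by rw [if_pos (Finset.mem_range.1 hj)]
  have hval : value μ S N d t w l X
      = ∑ i ∈ Finset.range (min d (l - t) + 1),
        ((if i = 0 then ip μ (S.Q l) X X + ip μ ((S.A l)ᵀ * P 0 (l + 1) * S.A l) X X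
            + ip μ ((S.C l)ᵀ * P 0 (l + 1) * S.C l) X X else 0)
          + (if i < d then h i else 0)
          - if i = min d (l - t) then ip μ (correction S d t P l) (Y i) (Y i) else 0) := by
    refine Finset.sum_congr rfl fun i _ => ?_
    change ip μ (P i l) (Y i) (Y i) = _
    rw [hPdef, riccati_eq hl, ip_matrix_sub _ _ (hYL i) (hYL i), ← hPdef]
    congr 1
    · rcases Nat.eq_zero_or_pos i with rfl | hi
      · have hXL := hX.memLp
        simp only [if_true, hh, hY0, if_pos (show 0 < d by omega), zero_add, Matrix.mul_add,
          Matrix.add_mul]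
        rw [ip_matrix_add _ _ hXL hXL, ip_matrix_add _ _ hXL hXL, ip_matrix_add _ _ hXL hXL]
        ring
      · rw [if_neg hi.ne', if_neg hi.ne', zero_add]
        split_ifs
        · rfl
        · exact ip_matrix_zero _ _
    · split_ifs
      · rfl
      · exact ip_matrix_zero _ _
  have hf : ∀ j, ip μ ((S.A l)ᵀ * P (j + 1) (l + 1) * S.A l) (μ[X | history w (l + 1 - (j + 1))])
      (μ[X | history w (l + 1 - (j + 1))]) = h j := fun j => by
    rw [Nat.add_sub_add_right]
  rw [Finset.sum_range_succ', Finset.sum_congr rfl fun j _ => hf j, hsum, hval,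
    Finset.sum_sub_distrib, Finset.sum_add_distrib, Finset.sum_ite_eq' _ 0,
    Finset.sum_ite_eq' _ (min d (l - t)), if_pos (by simp), if_pos (by simp), hinfo,
    Nat.sub_zero, condExp_state hw hX hl (Nat.le_succ l)]
  ring

/-- Both sides equal E[uᵀ M X]: the control cannot tell a finer estimate from its own. -/
theorem ip_control_condExp (hX : IsState μ w l X) (hu : IsControl μ w d t l u)
    (M : Matrix (Fin m) (Fin n) ℝ) (h1 : info w d t l ≤ 𝓖) (h2 : 𝓖 ≤ m0) :
    ip μ M u (μ[X | 𝓖]) = ip μ M u (μ[X | info w d t l]) := by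
  rw [ip_condExp_right M h2 (hu.measurable.mono h1 le_rfl) hu.memLp hX.memLp,
    ip_condExp_right M (h1.trans h2) hu.measurable hu.memLp hX.memLp]

/-- The change of the value function over one step. -/
theorem value_step (hw : IsNoise μ N w) (hd : 2 ≤ d) (htl : t ≤ l) (hl : l < N)
    (hQ : ∀ k, t ≤ k → k < N → (S.Q k).IsSymm) (hR : ∀ k, t ≤ k → k < N → (S.R k).IsSymm)
    (hG : S.G.IsSymm) (hX : IsState μ w l X) (hu : IsControl μ w d t l u) :
    ip μ (S.Q l) X X + ip μ (S.R l) u u + value μ S N d t w (l + 1) (next S w l X u)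
      = value μ S N d t w l X
        + ip μ (correction S d t (riccati S N d t) l) (μ[X | info w d t l]) (μ[X | info w d t l])
        + 2 * ip μ (H S d t (riccati S N d t) l) u (μ[X | info w d t l])
        + ip μ (W S d t (riccati S N d t) l) u u := by
  have hsymm := fun i => isSymm_riccati (d := d) hQ hR hG (show l + 1 ≤ N from hl) (by omega) i
  have hX' := hX.memLp_condExp (𝓖 := info w d t l)
  -- All cross terms are brought to the same delayed estimate, so that their coefficients can be
  -- summed into `H`.
  have hterm : ∀ i ∈ Finset.range (min d (l + 1 - t) + 1), ip μ (riccati S N d t i (l + 1))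
      (fun ω => S.A l *ᵥ (μ[X | history w (l + 1 - i)]) ω + S.B l *ᵥ u ω)
      (fun ω => S.A l *ᵥ (μ[X | history w (l + 1 - i)]) ω + S.B l *ᵥ u ω)
      = ip μ ((S.A l)ᵀ * riccati S N d t i (l + 1) * S.A l) (μ[X | history w (l + 1 - i)])
            (μ[X | history w (l + 1 - i)])
        + 2 * ip μ ((S.B l)ᵀ * riccati S N d t i (l + 1) * S.A l) u (μ[X | info w d t l])
        + ip μ ((S.B l)ᵀ * riccati S N d t i (l + 1) * S.B l) u u := fun i hi => by
    rw [Finset.mem_range] at hi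
    rw [ip_mulVec_add_self (hsymm i) _ _ (hX.memLp_condExp) hu.memLp,
      ip_control_condExp hX hu _ (history_mono (by omega)) (hw.history_le (by omega))]
  have hlast := ip_mulVec_add_self (hsymm 0) (S.C l) (S.D l) hX.memLp hu.memLp
  have hc := ip_control_condExp hX hu ((S.D l)ᵀ * riccati S N d t 0 (l + 1) * S.C l)
    (info_le_history htl) (hw.history_le hl.le)
  rw [condExp_state hw hX hl.le le_rfl] at hc
  rw [hc] at hlast
  have hmain := quadratic_eq_value (S := S) hw hd htl hl hX
  rw [value_next hw htl hl hX hu, Finset.sum_congr rfl hterm, Finset.sum_add_distrib,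
    Finset.sum_add_distrib, ← Finset.mul_sum, hlast, H, W, ip_matrix_add _ _ hu.memLp hX',
    ip_matrix_sum _ _ hu.memLp hX', ip_matrix_add _ _ hu.memLp hu.memLp,
    ip_matrix_add _ _ hu.memLp hu.memLp, ip_matrix_sum _ _ hu.memLp hu.memLp]
  linarith

/-- Completion of the square. -/
theorem value_step_of_posDef (hw : IsNoise μ N w) (hd : 2 ≤ d) (htl : t ≤ l) (hl : l < N)
    (hQ : ∀ k, t ≤ k → k < N → (S.Q k).IsSymm) (hR : ∀ k, t ≤ k → k < N → (S.R k).IsSymm)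
    (hG : S.G.IsSymm) (hW : (W S d t (riccati S N d t) l).PosDef)
    (hX : IsState μ w l X) (hu : IsControl μ w d t l u) :
    ip μ (S.Q l) X X + ip μ (S.R l) u u + value μ S N d t w (l + 1) (next S w l X u)
      = value μ S N d t w l X + ip μ (W S d t (riccati S N d t) l)
          (deviation μ S N d t w l X u) (deviation μ S N d t w l X u) := by
  have hdet := isUnit_det_of_posDef hW
  have hWs : (W S d t (riccati S N d t) l).IsSymm := isSymm_W (hR l htl hl) fun i =>
    isSymm_riccati hQ hR hG (show l + 1 ≤ N from hl) (by omega) i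
  -- The square of gain · X̂ + 1 · u: its cross coefficient is W · gain = H, and gainᵀ W gain is the
  -- correction.
  have h := ip_mulVec_add_self hWs (gain S N d t l) 1
    (hX.memLp_condExp (𝓖 := info w d t l)) hu.memLp
  have e1 : W S d t (riccati S N d t) l * gain S N d t l = H S d t (riccati S N d t) l := by
    rw [gain, ← Matrix.mul_assoc, mul_nonsing_inv _ hdet, Matrix.one_mul]
  have e2 : (gain S N d t l)ᵀ * W S d t (riccati S N d t) l * gain S N d t l
      = correction S d t (riccati S N d t) l := by
    rw [Matrix.mul_assoc, e1, gain, transpose_mul, transpose_nonsing_inv, hWs, correction,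
      pinv_eq_inv hdet]
  rw [e2, Matrix.mul_assoc 1ᵀ _ (gain S N d t l), e1] at h
  simp only [one_mulVec, transpose_one, Matrix.one_mul, Matrix.mul_one] at h
  rw [value_step hw hd htl hl hQ hR hG hX hu]
  unfold deviation
  rw [h]
  ring

/-- Along a trajectory the cost is the value of the initial state plus the cost of the deviations
from the feedback control. -/
theorem cost_eq_value_add (hw : IsNoise μ N w) (hd : 2 ≤ d)
    (hQ : ∀ k, t ≤ k → k < N → (S.Q k).IsSymm) (hR : ∀ k, t ≤ k → k < N → (S.R k).IsSymm)
    (hG : S.G.IsSymm) {X : ℕ → Ω → Fin n → ℝ} {u : ℕ → Ω → Fin m → ℝ} {k : ℕ} (hkN : k ≤ N)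
    (htk : t ≤ k) (hW : ∀ l, k ≤ l → l < N → (W S d t (riccati S N d t) l).PosDef)
    (hXk : IsState μ w k (X k)) (hu : ∀ l, k ≤ l → l < N → IsControl μ w d t l (u l))
    (hX : ∀ l, k ≤ l → l < N → X (l + 1) = next S w l (X l) (u l)) :
    ∑ l ∈ Finset.Ico k N, (ip μ (S.Q l) (X l) (X l) + ip μ (S.R l) (u l) (u l))
        + ip μ S.G (X N) (X N)
      = value μ S N d t w k (X k) + ∑ l ∈ Finset.Ico k N, ip μ (W S d t (riccati S N d t) l)
          (deviation μ S N d t w l (X l) (u l)) (deviation μ S N d t w l (X l) (u l)) := by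
  induction hkN using Nat.decreasingInduction with
  | self => simp [value_terminal hw hXk]
  | of_succ k hk ih =>
    have hstep := value_step_of_posDef hw hd htk hk hQ hR hG (hW k le_rfl hk) hXk (hu k le_rfl hk)
    have hnext := hXk.next (S := S) hw htk hk (hu k le_rfl hk)
    rw [← hX k le_rfl hk] at hstep hnext
    have ih := ih (by omega) (fun l hl => hW l (by omega)) hnext (fun l hl => hu l (by omega))
      (fun l hl => hX l (by omega))
    rw [Finset.sum_eq_sum_Ico_succ_bot hk, Finset.sum_eq_sum_Ico_succ_bot hk]
    linarith

end Value

/-! ### Open-loop and closed-loop trajectories -/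

section State

variable {Ω : Type*} {w : ℕ → Ω → ℝ} {n m k l : ℕ} {S : LQData n m} {ξ : Ω → Fin n → ℝ}
  {u : ℕ → Ω → Fin m → ℝ}

theorem state_self : state S w k ξ u k = ξ := by
  cases k with
  | zero => rfl
  | succ k => simp [state]

theorem state_succ (h : k ≤ l) :
    state S w k ξ u (l + 1) = next S w l (state S w k ξ u l) (u l) := by
  rw [state, if_neg (by omega)]
  rfl

theorem next_zero : next S w l (fun _ => 0) (fun _ => 0) = fun _ => 0 := by
  funext ω
  simp [next]

theorem state_add_smul (c : ℝ) (v h : ℕ → Ω → Fin m → ℝ) (hl : k ≤ l) :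
    state S w k ξ (fun j ω => v j ω + c • h j ω) l
      = fun ω => state S w k ξ v l ω + c • state S w k (fun _ => 0) h l ω := by
  induction l, hl using Nat.le_induction with
  | base => simp [state_self]
  | succ l hl ih =>
    rw [state_succ hl, state_succ hl, state_succ hl, ih]
    funext ω
    simp only [next, mulVec_add, mulVec_smul, smul_add, smul_comm c (w l ω)]
    abel

variable [m0 : MeasurableSpace Ω] {μ : Measure Ω} {N d t : ℕ}

theorem closedLoopState_self (K : ℕ → Matrix (Fin m) (Fin n) ℝ) :
    closedLoopState μ S d t w K k ξ k = ξ := by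
  cases k with
  | zero => rfl
  | succ k => simp [closedLoopState]

theorem closedLoopState_succ (K : ℕ → Matrix (Fin m) (Fin n) ℝ) (h : k ≤ l) :
    closedLoopState μ S d t w K k ξ (l + 1)
      = next S w l (closedLoopState μ S d t w K k ξ l) (feedbackControl μ S d t w K k ξ l) := by
  rw [closedLoopState, if_neg (by omega)]
  funext ω
  simp only [next, feedbackControl, mulVec_neg, sub_eq_add_neg]

theorem state_feedbackControl (K : ℕ → Matrix (Fin m) (Fin n) ℝ) (h : k ≤ l) :
    state S w k ξ (feedbackControl μ S d t w K k ξ) l = closedLoopState μ S d t w K k ξ l := by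
  induction l, h using Nat.le_induction with
  | base => rw [state_self, closedLoopState_self]
  | succ l hl ih => rw [state_succ hl, closedLoopState_succ K hl, ih]

theorem Admissible.isControl (hu : Admissible μ N d t w k u) (h1 : k ≤ l) (h2 : l < N) :
    IsControl μ w d t l (u l) :=
  ⟨(hu l h1 h2).1, (hu l h1 h2).2⟩

theorem isControl_feedbackControl (K : ℕ → Matrix (Fin m) (Fin n) ℝ)
    (hX : IsState μ w l (closedLoopState μ S d t w K k ξ l)) :
    IsControl μ w d t l (feedbackControl μ S d t w K k ξ l) :=
  ⟨(measurable_mulVec (K l) stronglyMeasurable_condExp.measurable).neg,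
    (memLp_mulVec (K l) hX.memLp_condExp).neg⟩

variable [IsProbabilityMeasure μ]

theorem Admissible.isState (hw : IsNoise μ N w) (htk : t ≤ k) (hξ : IsState μ w k ξ)
    (hu : Admissible μ N d t w k u) (hkl : k ≤ l) (hlN : l ≤ N) :
    IsState μ w l (state S w k ξ u l) := by
  induction l, hkl using Nat.le_induction with
  | base => rwa [state_self]
  | succ l hl ih =>
    rw [state_succ hl]
    exact (ih (by omega)).next hw (by omega) hlN (hu.isControl hl hlN)

theorem cost_eq_sum_ip (hw : IsNoise μ N w) (htk : t ≤ k) (hξ : IsState μ w k ξ)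
    (hu : Admissible μ N d t w k u) :
    cost μ S N w k ξ u = ∑ l ∈ Finset.Ico k N,
      (ip μ (S.Q l) (state S w k ξ u l) (state S w k ξ u l) + ip μ (S.R l) (u l) (u l))
      + ip μ S.G (state S w k ξ u N) (state S w k ξ u N) := by
  rw [cost]
  congr 1
  refine Finset.sum_congr rfl fun l hl => ?_
  obtain ⟨h1, h2⟩ := Finset.mem_Ico.1 hl
  have hX := (hu.isState (S := S) hw htk hξ h1 h2.le).memLp
  exact integral_add (integrable_dotProduct_mulVec _ hX hX)
    (integrable_dotProduct_mulVec _ (hu l h1 h2).2 (hu l h1 h2).2)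

theorem isState_closedLoopState (hw : IsNoise μ N w) (htk : t ≤ k) (hξ : IsState μ w k ξ)
    (K : ℕ → Matrix (Fin m) (Fin n) ℝ) (hkl : k ≤ l) (hlN : l ≤ N) :
    IsState μ w l (closedLoopState μ S d t w K k ξ l) := by
  induction l, hkl using Nat.le_induction with
  | base => rwa [closedLoopState_self]
  | succ l hl ih =>
    rw [closedLoopState_succ K hl]
    exact (ih (by omega)).next hw (by omega) hlN (isControl_feedbackControl K (ih (by omega)))

theorem admissible_feedbackControl (hw : IsNoise μ N w) (htk : t ≤ k) (hξ : IsState μ w k ξ)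
    (K : ℕ → Matrix (Fin m) (Fin n) ℝ) :
    Admissible μ N d t w k (feedbackControl μ S d t w K k ξ) := fun _ h1 h2 =>
  have h := isControl_feedbackControl K (isState_closedLoopState hw htk hξ K h1 h2.le)
  ⟨h.measurable, h.memLp⟩

theorem isState_zero : IsState μ w k (fun _ => (0 : Fin n → ℝ)) :=
  ⟨measurable_const, memLp_const _⟩

theorem isState_const (y : Fin n → ℝ) : IsState μ w k (fun _ => y) :=
  ⟨measurable_const, memLp_const _⟩

end State

/-! ### Optimality of the feedback control -/

section Optimality

variable {Ω : Type*} [m0 : MeasurableSpace Ω] {μ : Measure Ω}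
  {w : ℕ → Ω → ℝ} {n m N d t k : ℕ} {S : LQData n m} {ξ : Ω → Fin n → ℝ}
  {u : ℕ → Ω → Fin m → ℝ}

theorem ip_nonneg {p : ℕ} {M : Matrix (Fin p) (Fin p) ℝ} (hM : M.PosDef) (Y : Ω → Fin p → ℝ) :
    0 ≤ ip μ M Y Y :=
  integral_nonneg fun ω => dotProduct_mulVec_nonneg hM (Y ω)

theorem ae_eq_zero_of_ip_eq_zero {p : ℕ} {M : Matrix (Fin p) (Fin p) ℝ} (hM : M.PosDef)
    {Y : Ω → Fin p → ℝ} (hY : MemLp Y 2 μ) (h : ip μ M Y Y = 0) : Y =ᵐ[μ] fun _ => 0 := by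
  have h0 := (integral_eq_zero_iff_of_nonneg (fun ω => dotProduct_mulVec_nonneg hM (Y ω))
    (integrable_dotProduct_mulVec M hY hY)).1 h
  filter_upwards [h0] with ω hω
  by_contra hne
  exact (dotProduct_mulVec_pos hM hne).ne' hω

theorem condExp_const_zero {p : ℕ} (𝓖 : MeasurableSpace Ω) :
    μ[(fun _ => 0 : Ω → Fin p → ℝ) | 𝓖] = fun _ => 0 :=
  condExp_zero

theorem ip_zero_zero {p q : ℕ} (M : Matrix (Fin p) (Fin q) ℝ) :
    ip μ M (fun _ => 0) (fun _ => 0) = 0 := by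
  simp [ip]

theorem value_zero (l : ℕ) : value μ S N d t w l (fun _ => 0) = 0 :=
  Finset.sum_eq_zero fun i _ => by rw [condExp_const_zero, ip_zero_zero]

theorem deviation_feedbackControl {K : ℕ → Matrix (Fin m) (Fin n) ℝ} {l : ℕ}
    (hK : K l = gain S N d t l) :
    deviation μ S N d t w l (closedLoopState μ S d t w K k ξ l)
      (feedbackControl μ S d t w K k ξ l) = fun _ => 0 := by
  funext ω
  simp only [deviation, feedbackControl, hK, add_neg_cancel]

/-- The homogeneous problem has no nonzero control of nonpositive cost. -/
def StrictlyPositive (μ : Measure Ω) (S : LQData n m) (N d t : ℕ) (w : ℕ → Ω → ℝ) : Prop :=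
  ∀ u : ℕ → Ω → Fin m → ℝ, Admissible μ N d t w t u → cost μ S N w t (fun _ => 0) u ≤ 0 →
    ∀ l, t ≤ l → l < N → u l =ᵐ[μ] fun _ => 0

theorem ip_add_smul_self {p : ℕ} (M : Matrix (Fin p) (Fin p) ℝ) (c : ℝ) {Y Z : Ω → Fin p → ℝ}
    (hY : MemLp Y 2 μ) (hZ : MemLp Z 2 μ) :
    ip μ M (fun ω => Y ω + c • Z ω) (fun ω => Y ω + c • Z ω)
      = ip μ M Y Y + c * (ip μ M Y Z + ip μ M Z Y) + c ^ 2 * ip μ M Z Z := by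
  have hc : MemLp (fun ω => c • Z ω) 2 μ := hZ.const_smul c
  have hYc : MemLp (fun ω => Y ω + c • Z ω) 2 μ := hY.add hc
  rw [ip_add_left M hY hc hYc, ip_add_right M hY hY hc, ip_add_right M hc hY hc]
  simp only [ip, mulVec_smul, dotProduct_smul, smul_dotProduct, smul_eq_mul, integral_const_mul]
  ring

theorem Admissible.add_smul {v h : ℕ → Ω → Fin m → ℝ} (hv : Admissible μ N d t w k v)
    (hh : Admissible μ N d t w k h) (c : ℝ) :
    Admissible μ N d t w k (fun l ω => v l ω + c • h l ω) := fun l h1 h2 =>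
  ⟨(hv l h1 h2).1.add ((hh l h1 h2).1.const_smul c),
    (hv l h1 h2).2.add ((hh l h1 h2).2.const_smul c)⟩

theorem UniformlyConvex.strictlyPositive (h : UniformlyConvex μ S N d t w t) :
    StrictlyPositive μ S N d t w := by
  obtain ⟨c, hc, h⟩ := h
  intro u hu hle l h1 h2
  have hnn : ∀ l ∈ Finset.Ico t N, 0 ≤ ∫ ω, u l ω ⬝ᵥ u l ω ∂μ := fun l _ => by
    simpa [ip] using ip_nonneg (μ := μ) PosDef.one (u l)
  have hs : ∑ l ∈ Finset.Ico t N, ∫ ω, u l ω ⬝ᵥ u l ω ∂μ = 0 := by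
    refine le_antisymm ?_ (Finset.sum_nonneg hnn)
    have := (h u hu).trans hle
    by_contra hlt
    exact absurd this (not_le.2 (mul_pos hc (not_le.1 hlt)))
  have h0 := (Finset.sum_eq_zero_iff_of_nonneg hnn).1 hs l (Finset.mem_Ico.2 ⟨h1, h2⟩)
  exact ae_eq_zero_of_ip_eq_zero PosDef.one (hu l h1 h2).2 (by simpa [ip] using h0)

/-- The control which is zero before time `k`, equal to `y` at time `k`, and the feedback control
afterwards. -/
noncomputable def probe (μ : Measure Ω) (S : LQData n m) (N d t : ℕ) (w : ℕ → Ω → ℝ) (k : ℕ)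
    (y : Fin m → ℝ) (l : ℕ) : Ω → Fin m → ℝ :=
  if l < k then fun _ => 0 else if l = k then fun _ => y else
    feedbackControl μ S d t w (gain S N d t) (k + 1) (next S w k (fun _ => 0) fun _ => y) l

theorem state_probe_le (y : Fin m → ℝ) {l : ℕ} (h1 : t ≤ l) (h2 : l ≤ k) :
    state S w t (fun _ => 0) (probe μ S N d t w k y) l = fun _ => 0 := by
  induction l, h1 using Nat.le_induction with
  | base => exact state_self
  | succ l hl ih => rw [state_succ hl, ih (by omega), probe, if_pos (by omega), next_zero]

theorem state_probe_gt (y : Fin m → ℝ) (htk : t ≤ k) {l : ℕ} (h : k + 1 ≤ l) :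
    state S w t (fun _ => 0) (probe μ S N d t w k y) l
      = closedLoopState μ S d t w (gain S N d t) (k + 1)
          (next S w k (fun _ => 0) fun _ => y) l := by
  induction l, h using Nat.le_induction with
  | base =>
    rw [state_succ htk, state_probe_le y htk le_rfl, closedLoopState_self, probe,
      if_neg (by omega), if_pos rfl]
  | succ l hl ih =>
    rw [state_succ (by omega), ih, closedLoopState_succ _ hl, probe, if_neg (by omega),
      if_neg (by omega)]

variable [IsProbabilityMeasure μ]

theorem ip_const {p q : ℕ} (M : Matrix (Fin p) (Fin q) ℝ) (y : Fin p → ℝ) (z : Fin q → ℝ) :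
    ip μ M (fun _ => y) (fun _ => z) = y ⬝ᵥ (M *ᵥ z) := by
  simp [ip]

theorem cost_eq_value (hw : IsNoise μ N w) (hd : 2 ≤ d)
    (hQ : ∀ k, t ≤ k → k < N → (S.Q k).IsSymm) (hR : ∀ k, t ≤ k → k < N → (S.R k).IsSymm)
    (hG : S.G.IsSymm) (hkN : k ≤ N) (htk : t ≤ k)
    (hW : ∀ l, k ≤ l → l < N → (W S d t (riccati S N d t) l).PosDef) (hξ : IsState μ w k ξ)
    (hu : Admissible μ N d t w k u) :
    cost μ S N w k ξ u = value μ S N d t w k ξ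
      + ∑ l ∈ Finset.Ico k N, ip μ (W S d t (riccati S N d t) l)
          (deviation μ S N d t w l (state S w k ξ u l) (u l))
          (deviation μ S N d t w l (state S w k ξ u l) (u l)) := by
  rw [cost_eq_sum_ip hw htk hξ hu, cost_eq_value_add hw hd hQ hR hG hkN htk hW
    (hu.isState hw htk hξ le_rfl hkN) (fun _ => hu.isControl) (fun l h _ => state_succ h),
    state_self]

/-- If the matrices `W_l` are positive definite, then the feedback control is the only optimal
control. -/
theorem isUniqueOptimal_feedbackControl (hw : IsNoise μ N w) (hd : 2 ≤ d)
    (hQ : ∀ k, t ≤ k → k < N → (S.Q k).IsSymm) (hR : ∀ k, t ≤ k → k < N → (S.R k).IsSymm)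
    (hG : S.G.IsSymm) (hkN : k ≤ N) (htk : t ≤ k)
    (hW : ∀ l, k ≤ l → l < N → (W S d t (riccati S N d t) l).PosDef) (hξ : IsState μ w k ξ)
    {K : ℕ → Matrix (Fin m) (Fin n) ℝ} (hK : ∀ l, k ≤ l → l < N → K l = gain S N d t l) :
    IsUniqueOptimal μ S N d t w k ξ (feedbackControl μ S d t w K k ξ) := by
  have hfb := admissible_feedbackControl (N := N) (d := d) (S := S) hw htk hξ K
  have hcost := fun {u} (hu : Admissible μ N d t w k u) =>
    cost_eq_value hw hd hQ hR hG hkN htk hW hξ hu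
  have hnonneg := fun (u : ℕ → Ω → Fin m → ℝ) (l : ℕ) (hl : l ∈ Finset.Ico k N) =>
    ip_nonneg (μ := μ) (hW l (Finset.mem_Ico.1 hl).1 (Finset.mem_Ico.1 hl).2)
      (deviation μ S N d t w l (state S w k ξ u l) (u l))
  have hfbcost : cost μ S N w k ξ (feedbackControl μ S d t w K k ξ) = value μ S N d t w k ξ := by
    rw [hcost hfb, Finset.sum_eq_zero, add_zero]
    intro l hl
    obtain ⟨h1, h2⟩ := Finset.mem_Ico.1 hl
    rw [state_feedbackControl K h1, deviation_feedbackControl (hK l h1 h2), ip_zero_zero]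
  refine ⟨⟨hfb, fun u hu => ?_⟩, fun u hu => ?_⟩
  · rw [hfbcost, hcost hu]
    exact le_add_of_nonneg_right (Finset.sum_nonneg (hnonneg u))
  · have hle := hu.2 _ hfb
    rw [hfbcost, hcost hu.1] at hle
    -- The feedback attains the value, so an optimal control leaves no room for the nonnegative
    -- deviation terms.
    have hzero := (Finset.sum_eq_zero_iff_of_nonneg (hnonneg u)).1
      (le_antisymm (by linarith) (Finset.sum_nonneg (hnonneg u)))
    have hdev : ∀ l, k ≤ l → l < N →
        deviation μ S N d t w l (state S w k ξ u l) (u l) =ᵐ[μ] fun _ => 0 := fun l h1 h2 =>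
      ae_eq_zero_of_ip_eq_zero (hW l h1 h2)
        (memLp_deviation (hu.1.isState hw htk hξ h1 h2.le) (hu.1.isControl h1 h2))
        (hzero l (Finset.mem_Ico.2 ⟨h1, h2⟩))
    -- Zero deviation makes `u` the feedback of its own state; equality with the closed loop then
    -- propagates forward in time through `hstate`.
    have hctrl : ∀ l, k ≤ l → l < N →
        state S w k ξ u l =ᵐ[μ] closedLoopState μ S d t w K k ξ l →
        u l =ᵐ[μ] feedbackControl μ S d t w K k ξ l := fun l h1 h2 hs => by
      filter_upwards [hdev l h1 h2, condExp_congr_ae (m := info w d t l) hs] with ω e1 e2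
      rw [deviation, e2] at e1
      rw [feedbackControl, hK l h1 h2]
      exact eq_neg_of_add_eq_zero_right e1
    have hstate : ∀ l, k ≤ l → l ≤ N →
        state S w k ξ u l =ᵐ[μ] closedLoopState μ S d t w K k ξ l := fun l hkl => by
      induction l, hkl using Nat.le_induction with
      | base => intro _; rw [state_self, closedLoopState_self]
      | succ l hl ih =>
        intro hlN
        have e := ih (by omega)
        rw [state_succ hl, closedLoopState_succ K hl]
        filter_upwards [e, hctrl l hl hlN e] with ω e1 e2
        rw [next, next, e1, e2]
    exact fun l h1 h2 => hctrl l h1 h2 (hstate l h1 h2.le)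

/-! ### Definiteness of the cost and definiteness of the matrices `W` -/

/-- The cost is a quadratic polynomial along each line of admissible controls. -/
theorem exists_cost_add_smul (hw : IsNoise μ N w) (htk : t ≤ k) (hkN : k ≤ N)
    (hξ : IsState μ w k ξ) {v h : ℕ → Ω → Fin m → ℝ} (hv : Admissible μ N d t w k v)
    (hh : Admissible μ N d t w k h) :
    ∃ b : ℝ, ∀ c : ℝ, cost μ S N w k ξ (fun l ω => v l ω + c • h l ω)
      = cost μ S N w k ξ v + c * b + c ^ 2 * cost μ S N w k (fun _ => 0) h := by
  set X := state S w k ξ v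
  set Z := state S w k (fun _ => 0) h
  have hX : ∀ l, k ≤ l → l ≤ N → MemLp (X l) 2 μ := fun l h1 h2 =>
    (hv.isState hw htk hξ h1 h2).memLp
  have hZ : ∀ l, k ≤ l → l ≤ N → MemLp (Z l) 2 μ := fun l h1 h2 =>
    (hh.isState hw htk isState_zero h1 h2).memLp
  refine ⟨∑ l ∈ Finset.Ico k N, (ip μ (S.Q l) (X l) (Z l) + ip μ (S.Q l) (Z l) (X l)
    + (ip μ (S.R l) (v l) (h l) + ip μ (S.R l) (h l) (v l)))
    + (ip μ S.G (X N) (Z N) + ip μ S.G (Z N) (X N)), fun c => ?_⟩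
  rw [cost_eq_sum_ip hw htk hξ (hv.add_smul hh c), cost_eq_sum_ip hw htk hξ hv,
    cost_eq_sum_ip hw htk isState_zero hh, state_add_smul c v h hkN,
    ip_add_smul_self _ c (hX N hkN le_rfl) (hZ N hkN le_rfl)]
  have hsum : ∀ l ∈ Finset.Ico k N,
      ip μ (S.Q l) (state S w k ξ (fun l ω => v l ω + c • h l ω) l)
        (state S w k ξ (fun l ω => v l ω + c • h l ω) l)
        + ip μ (S.R l) (fun ω => v l ω + c • h l ω) (fun ω => v l ω + c • h l ω)
      = (ip μ (S.Q l) (X l) (X l) + ip μ (S.R l) (v l) (v l))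
        + c * (ip μ (S.Q l) (X l) (Z l) + ip μ (S.Q l) (Z l) (X l)
          + (ip μ (S.R l) (v l) (h l) + ip μ (S.R l) (h l) (v l)))
        + c ^ 2 * (ip μ (S.Q l) (Z l) (Z l) + ip μ (S.R l) (h l) (h l)) := fun l hl => by
    obtain ⟨h1, h2⟩ := Finset.mem_Ico.1 hl
    rw [state_add_smul c v h h1, ip_add_smul_self _ c (hX l h1 h2.le) (hZ l h1 h2.le),
      ip_add_smul_self _ c (hv l h1 h2).2 (hh l h1 h2).2]
    ring
  rw [Finset.sum_congr rfl hsum, Finset.sum_add_distrib, Finset.sum_add_distrib,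
    ← Finset.mul_sum, ← Finset.mul_sum]
  ring

/-- If a direction `u` has nonpositive homogeneous cost q, the cost along v + c u is J(v) + c b + c²
q. Minimality at c = -1 gives b ≤ q, so at c = 1 the cost is at most J(v) + 2q ≤ J(v). Thus v + u is
optimal too, and uniqueness forces u = 0. -/
theorem UniquelySolvable.strictlyPositive (hw : IsNoise μ N w) (ht : t ≤ N)
    (hξ : IsState μ w t ξ) (h : UniquelySolvable μ S N d t w t ξ) :
    StrictlyPositive μ S N d t w := by
  obtain ⟨v, hv, huniq⟩ := h
  intro u hu hle l h1 h2
  obtain ⟨b, hb⟩ := exists_cost_add_smul (S := S) hw le_rfl ht hξ hv.1 hu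
  have hmin := hv.2 _ (hv.1.add_smul hu (-1))
  have hopt : IsOptimal μ S N d t w t ξ (fun l ω => v l ω + (1 : ℝ) • u l ω) := by
    refine ⟨hv.1.add_smul hu 1, fun u' hu' => le_trans ?_ (hv.2 u' hu')⟩
    rw [hb] at hmin ⊢
    linarith
  filter_upwards [huniq _ hopt l h1 h2] with ω hω
  simpa using hω

theorem isState_next_probe (hw : IsNoise μ N w) (htk : t ≤ k) (hkN : k < N) (y : Fin m → ℝ) :
    IsState μ w (k + 1) (next S w k (fun _ => 0) fun _ => y) :=
  -- A constant control is admissible for every delay, and the conclusion does not involve the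
  -- delay; 0 is an arbitrary choice.
  isState_zero.next (d := 0) hw htk hkN ⟨measurable_const, memLp_const y⟩

theorem admissible_probe (hw : IsNoise μ N w) (htk : t ≤ k) (hkN : k < N) (y : Fin m → ℝ) :
    Admissible μ N d t w t (probe μ S N d t w k y) := fun l _ h2 => by
  unfold probe
  split_ifs
  · exact ⟨measurable_const, memLp_const 0⟩
  · exact ⟨measurable_const, memLp_const y⟩
  · exact admissible_feedbackControl hw (by omega) (isState_next_probe hw htk hkN y) _ l
      (by omega) h2

/-- Nothing is paid while state and control are zero, and after k the feedback has no deviation. At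
time k the identity `value_step`, which needs no definiteness of W_k, leaves only the quadratic term
in y. -/
theorem cost_probe (hw : IsNoise μ N w) (hd : 2 ≤ d)
    (hQ : ∀ k, t ≤ k → k < N → (S.Q k).IsSymm) (hR : ∀ k, t ≤ k → k < N → (S.R k).IsSymm)
    (hG : S.G.IsSymm) (hkN : k < N) (htk : t ≤ k)
    (hW : ∀ l, k + 1 ≤ l → l < N → (W S d t (riccati S N d t) l).PosDef) (y : Fin m → ℝ) :
    cost μ S N w t (fun _ => 0) (probe μ S N d t w k y)
      = y ⬝ᵥ (W S d t (riccati S N d t) k *ᵥ y) := by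
  have hadm := admissible_probe (S := S) (d := d) hw htk hkN y
  have hk : probe μ S N d t w k y k = fun _ => y := by
    rw [probe, if_neg (lt_irrefl k), if_pos rfl]
  -- The cost identity is applied to the tail from k + 1 of the trajectory started at t, where
  -- definiteness is available.
  have hafter := cost_eq_value_add hw hd hQ hR hG (X := state S w t (fun _ => 0)
    (probe μ S N d t w k y)) (u := probe μ S N d t w k y) hkN (by omega) hW
    (hadm.isState hw le_rfl isState_zero (by omega) hkN)
    (fun l h1 h2 => hadm.isControl (by omega) h2) (fun l h1 _ => state_succ (by omega))
  have hstep := value_step hw hd htk hkN hQ hR hG (isState_zero (n := n))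
    (hadm.isControl htk hkN)
  rw [hk, condExp_const_zero, value_zero, ip_zero_zero, ip_zero_zero, ip_const, ip_const,
    ip_const, mulVec_zero, dotProduct_zero] at hstep
  rw [Finset.sum_eq_zero (s := Finset.Ico (k + 1) N)
    (f := fun l => ip μ _ (deviation _ _ _ _ _ _ _ _ _) _), state_probe_gt y htk le_rfl,
    closedLoopState_self] at hafter
  · rw [cost_eq_sum_ip hw le_rfl isState_zero hadm,
      ← Finset.sum_Ico_consecutive _ htk hkN.le, Finset.sum_eq_sum_Ico_succ_bot hkN,
      Finset.sum_eq_zero, state_probe_le y htk le_rfl, hk, ip_zero_zero, ip_const]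
    · linarith
    · intro l hl
      obtain ⟨h1, h2⟩ := Finset.mem_Ico.1 hl
      rw [state_probe_le y h1 h2.le, probe, if_pos h2, ip_zero_zero, ip_zero_zero, add_zero]
  · intro l hl
    obtain ⟨h1, h2⟩ := Finset.mem_Ico.1 hl
    rw [state_probe_gt y htk h1, probe, if_neg (by omega), if_neg (by omega),
      deviation_feedbackControl rfl, ip_zero_zero]

/-- Backward induction: once the later `W` are definite, yᵀ W_k y is the cost of an admissible
control, so it can be nonpositive only if y = 0. -/
theorem StrictlyPositive.posDef (hw : IsNoise μ N w) (hd : 2 ≤ d)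
    (hQ : ∀ k, t ≤ k → k < N → (S.Q k).IsSymm) (hR : ∀ k, t ≤ k → k < N → (S.R k).IsSymm)
    (hG : S.G.IsSymm) (h : StrictlyPositive μ S N d t w) (hkN : k ≤ N) (htk : t ≤ k) :
    ∀ l, k ≤ l → l < N → (W S d t (riccati S N d t) l).PosDef := by
  induction hkN using Nat.decreasingInduction with
  | self => intro l h1 h2; omega
  | of_succ k hk ih =>
    have ih := ih (by omega)
    intro l h1 h2
    rcases h1.eq_or_lt with rfl | h1
    · refine posDef_of_isSymm (isSymm_W (hR k htk hk) fun i =>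
        isSymm_riccati hQ hR hG (show k + 1 ≤ N from hk) (by omega) i) fun y hy => ?_
      by_contra hle
      rw [not_lt, ← cost_probe hw hd hQ hR hG hk htk ih y] at hle
      have h0 := h _ (admissible_probe hw htk hk y) hle k htk hk
      rw [probe, if_neg (lt_irrefl k), if_pos rfl] at h0
      obtain ⟨ω, hω⟩ := h0.exists
      exact hy hω
    · exact ih l h1 h2

end Optimality

/-! ### Uniform convexity -/

section Convexity

variable {p q : ℕ}

theorem norm_sq_le_dotProduct (y : Fin p → ℝ) : ‖y‖ ^ 2 ≤ y ⬝ᵥ y := by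
  have h0 : 0 ≤ y ⬝ᵥ y := Finset.sum_nonneg fun i _ => mul_self_nonneg (y i)
  have h : ‖y‖ ≤ √(y ⬝ᵥ y) := by
    refine (pi_norm_le_iff_of_nonneg (Real.sqrt_nonneg _)).2 fun i => Real.abs_le_sqrt ?_
    rw [sq]
    exact Finset.single_le_sum (f := fun i => y i * y i) (fun i _ => mul_self_nonneg (y i))
      (Finset.mem_univ i)
  calc ‖y‖ ^ 2 ≤ √(y ⬝ᵥ y) ^ 2 := by gcongr
    _ = y ⬝ᵥ y := Real.sq_sqrt h0

theorem exists_dotProduct_mulVec_le (A : Matrix (Fin p) (Fin q) ℝ) :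
    ∃ c : ℝ, 0 ≤ c ∧ ∀ y : Fin q → ℝ, (A *ᵥ y) ⬝ᵥ (A *ᵥ y) ≤ c * (y ⬝ᵥ y) := by
  let L := (Matrix.mulVecLin A).toContinuousLinearMap
  refine ⟨p * ‖L‖ ^ 2, by positivity, fun y => ?_⟩
  calc (A *ᵥ y) ⬝ᵥ (A *ᵥ y) ≤ p * ‖A *ᵥ y‖ ^ 2 := dotProduct_le_norm_sq _
    _ ≤ p * (‖L‖ * ‖y‖) ^ 2 := by gcongr; exact L.le_opNorm y
    _ = p * ‖L‖ ^ 2 * ‖y‖ ^ 2 := by ring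
    _ ≤ _ := by gcongr; exact norm_sq_le_dotProduct y

variable {Ω : Type*} {𝓖 : MeasurableSpace Ω} [m0 : MeasurableSpace Ω] {μ : Measure Ω}

theorem ip_one_add_le {Y Z : Ω → Fin p → ℝ} (hY : MemLp Y 2 μ) (hZ : MemLp Z 2 μ) :
    ip μ 1 (fun ω => Y ω + Z ω) (fun ω => Y ω + Z ω) ≤ 2 * ip μ 1 Y Y + 2 * ip μ 1 Z Z := by
  have hYZ : MemLp (fun ω => Y ω + Z ω) 2 μ := hY.add hZ
  have h1 := integrable_dotProduct_mulVec 1 hY hY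
  have h2 := integrable_dotProduct_mulVec 1 hZ hZ
  simp only [ip]
  rw [← integral_const_mul, ← integral_const_mul,
    ← integral_add (h1.const_mul 2) (h2.const_mul 2)]
  refine integral_mono (integrable_dotProduct_mulVec 1 hYZ hYZ)
    ((h1.const_mul 2).add (h2.const_mul 2)) fun ω => ?_
  simp only [one_mulVec, dotProduct, Pi.add_apply, Finset.mul_sum]
  rw [← Finset.sum_add_distrib]
  exact Finset.sum_le_sum fun i _ => by nlinarith [sq_nonneg (Y ω i - Z ω i)]

theorem exists_ip_one_mulVec_le (A : Matrix (Fin p) (Fin q) ℝ) :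
    ∃ c : ℝ, 0 ≤ c ∧ ∀ Y : Ω → Fin q → ℝ, MemLp Y 2 μ →
      ip μ 1 (fun ω => A *ᵥ Y ω) (fun ω => A *ᵥ Y ω) ≤ c * ip μ 1 Y Y := by
  obtain ⟨c, hc, h⟩ := exists_dotProduct_mulVec_le A
  refine ⟨c, hc, fun Y hY => ?_⟩
  simp only [ip]
  rw [← integral_const_mul]
  exact integral_mono (integrable_dotProduct_mulVec 1 (memLp_mulVec A hY) (memLp_mulVec A hY))
    ((integrable_dotProduct_mulVec 1 hY hY).const_mul c) fun ω => by
      simpa only [one_mulVec] using h (Y ω)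

theorem exists_ip_one_le_of_posDef {M : Matrix (Fin p) (Fin p) ℝ} (hM : M.PosDef) :
    ∃ c : ℝ, 0 ≤ c ∧ ∀ Y : Ω → Fin p → ℝ, MemLp Y 2 μ → ip μ 1 Y Y ≤ c * ip μ M Y Y := by
  obtain ⟨c, hc, h⟩ := exists_pos_mul_le_of_posDef hM
  refine ⟨c⁻¹, by positivity, fun Y hY => ?_⟩
  simp only [ip]
  rw [← integral_const_mul]
  refine integral_mono (integrable_dotProduct_mulVec 1 hY hY)
    ((integrable_dotProduct_mulVec M hY hY).const_mul _) fun ω => ?_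
  rw [one_mulVec, le_inv_mul_iff₀ hc]
  exact h (Y ω)

/-- Expanding 0 ≤ E|X - E[X | 𝓖]|² gives the claim, since the cross term is E|E[X | 𝓖]|². -/
theorem ip_one_condExp_le [IsFiniteMeasure μ] (h𝓖 : 𝓖 ≤ m0) {X : Ω → Fin p → ℝ}
    (hX : MemLp X 2 μ) : ip μ 1 (μ[X | 𝓖]) (μ[X | 𝓖]) ≤ ip μ 1 X X := by
  have hE : MemLp (μ[X | 𝓖]) 2 μ := hX.condExp (by norm_num)
  have h1 := ip_condExp_right 1 h𝓖 stronglyMeasurable_condExp.measurable hE hX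
  have h2 := ip_add_smul_self 1 (-1) hX hE
  have h3 := ip_nonneg (μ := μ) PosDef.one fun ω => X ω + (-1 : ℝ) • (μ[X | 𝓖]) ω
  have h4 := ip_transpose (μ := μ) 1 X (μ[X | 𝓖])
  rw [transpose_one] at h4
  rw [h2] at h3
  linarith

variable {w : ℕ → Ω → ℝ} {n m N d t k l : ℕ} {S : LQData n m} [IsProbabilityMeasure μ]

/-- The control is its deviation minus the gain applied to the estimate, and conditional expectation
is a contraction. -/
theorem exists_ip_one_control_le (hw : IsNoise μ N w) (htl : t ≤ l) (hl : l < N) :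
    ∃ c : ℝ, 0 ≤ c ∧ ∀ (X : Ω → Fin n → ℝ) (u : Ω → Fin m → ℝ), IsState μ w l X →
      IsControl μ w d t l u → ip μ 1 u u ≤ c * (ip μ 1 X X
        + ip μ 1 (deviation μ S N d t w l X u) (deviation μ S N d t w l X u)) := by
  obtain ⟨c, hc, h⟩ := exists_ip_one_mulVec_le (μ := μ) (-gain S N d t l)
  refine ⟨2 * c + 2, by positivity, fun X u hX hu => ?_⟩
  have hdev := memLp_deviation (S := S) (N := N) hX hu
  have hE : MemLp (μ[X | info w d t l]) 2 μ := hX.memLp_condExp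
  have e : u = fun ω => -gain S N d t l *ᵥ (μ[X | info w d t l]) ω
      + deviation μ S N d t w l X u ω := by
    funext ω
    simp only [deviation, neg_mulVec, neg_add_cancel_left]
  have h1 := ip_one_add_le (memLp_mulVec (-gain S N d t l) hE) hdev
  rw [← e] at h1
  have h2 := h _ hE
  have h3 := mul_le_mul_of_nonneg_left
    (ip_one_condExp_le (hw.info_le (d := d) htl hl.le) hX.memLp) hc
  have h4 := ip_nonneg (μ := μ) PosDef.one X
  have h5 := mul_nonneg hc (ip_nonneg (μ := μ) PosDef.one (deviation μ S N d t w l X u))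
  linarith

theorem exists_ip_one_next_le (hw : IsNoise μ N w) (htl : t ≤ l) (hl : l < N) :
    ∃ c : ℝ, 0 ≤ c ∧ ∀ (X : Ω → Fin n → ℝ) (u : Ω → Fin m → ℝ), IsState μ w l X →
      IsControl μ w d t l u →
      ip μ 1 (next S w l X u) (next S w l X u) ≤ c * (ip μ 1 X X + ip μ 1 u u) := by
  obtain ⟨a, ha, hA⟩ := exists_ip_one_mulVec_le (μ := μ) (S.A l)
  obtain ⟨b, hb, hB⟩ := exists_ip_one_mulVec_le (μ := μ) (S.B l)
  obtain ⟨c, hc, hC⟩ := exists_ip_one_mulVec_le (μ := μ) (S.C l)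
  obtain ⟨e, he, hD⟩ := exists_ip_one_mulVec_le (μ := μ) (S.D l)
  refine ⟨2 * (a + b + c + e), by positivity, fun X u hX hu => ?_⟩
  rw [ip_next hw htl hl hX hu]
  have h1 := ip_one_add_le (memLp_mulVec (S.A l) hX.memLp) (memLp_mulVec (S.B l) hu.memLp)
  have h2 := ip_one_add_le (memLp_mulVec (S.C l) hX.memLp) (memLp_mulVec (S.D l) hu.memLp)
  have hX0 := ip_nonneg (μ := μ) PosDef.one X
  have hu0 := ip_nonneg (μ := μ) PosDef.one u
  have := hA X hX.memLp
  have := hB u hu.memLp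
  have := hC X hX.memLp
  have := hD u hu.memLp
  nlinarith [mul_nonneg ha hu0, mul_nonneg hb hX0, mul_nonneg hc hu0, mul_nonneg he hX0]

/-- If the matrices `W_l` are positive definite, then the cost is uniformly convex. -/
theorem uniformlyConvex_of_posDef (hw : IsNoise μ N w) (hd : 2 ≤ d)
    (hQ : ∀ k, t ≤ k → k < N → (S.Q k).IsSymm) (hR : ∀ k, t ≤ k → k < N → (S.R k).IsSymm)
    (hG : S.G.IsSymm) (hkN : k ≤ N) (htk : t ≤ k)
    (hW : ∀ l, k ≤ l → l < N → (W S d t (riccati S N d t) l).PosDef) :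
    UniformlyConvex μ S N d t w k := by
  have hcost := fun {u} (hu : Admissible μ N d t w k u) => (cost_eq_value hw hd hQ hR hG hkN htk hW
    isState_zero hu).trans (by rw [value_zero, zero_add])
  have hterm : ∀ {u}, Admissible μ N d t w k u → ∀ l ∈ Finset.Ico k N,
      0 ≤ ip μ (W S d t (riccati S N d t) l)
        (deviation μ S N d t w l (state S w k (fun _ => 0) u l) (u l))
        (deviation μ S N d t w l (state S w k (fun _ => 0) u l) (u l)) := fun _ l hl =>
    ip_nonneg (hW l (Finset.mem_Ico.1 hl).1 (Finset.mem_Ico.1 hl).2) _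
  have hstate : ∀ {u}, Admissible μ N d t w k u → ∀ l, k ≤ l → l ≤ N →
      IsState μ w l (state S w k (fun _ => 0) u l) := fun hu l h1 h2 =>
    hu.isState hw htk isState_zero h1 h2
  -- From the zero state the cost is exactly the sum of the nonnegative deviation terms, so it
  -- dominates each of them.
  have hdev : ∀ l, k ≤ l → l < N → ∃ c : ℝ, 0 ≤ c ∧ ∀ u, Admissible μ N d t w k u →
      ip μ 1 (deviation μ S N d t w l (state S w k (fun _ => 0) u l) (u l))
        (deviation μ S N d t w l (state S w k (fun _ => 0) u l) (u l))
        ≤ c * cost μ S N w k (fun _ => 0) u := fun l h1 h2 => by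
    obtain ⟨c, hc, h⟩ := exists_ip_one_le_of_posDef (μ := μ) (hW l h1 h2)
    refine ⟨c, hc, fun u hu => (h _ (memLp_deviation (hstate hu l h1 h2.le)
      (hu.isControl h1 h2))).trans ?_⟩
    rw [hcost hu]
    exact mul_le_mul_of_nonneg_left
      (Finset.single_le_sum (hterm hu) (Finset.mem_Ico.2 ⟨h1, h2⟩)) hc
  -- The state bound is a premise, because this step also serves inside the forward induction that
  -- proves it.
  have hctrl : ∀ l, k ≤ l → l < N → (∃ c : ℝ, 0 ≤ c ∧ ∀ u, Admissible μ N d t w k u →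
      ip μ 1 (state S w k (fun _ => 0) u l) (state S w k (fun _ => 0) u l)
        ≤ c * cost μ S N w k (fun _ => 0) u) →
      ∃ c : ℝ, 0 ≤ c ∧ ∀ u, Admissible μ N d t w k u →
        ip μ 1 (u l) (u l) ≤ c * cost μ S N w k (fun _ => 0) u := fun l h1 h2 hs => by
    obtain ⟨a, ha, hA⟩ := hs
    obtain ⟨b, hb, hB⟩ := hdev l h1 h2
    obtain ⟨c, hc, hC⟩ := exists_ip_one_control_le (d := d) (S := S) hw (htk.trans h1) h2
    refine ⟨c * (a + b), by positivity, fun u hu => ?_⟩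
    calc _ ≤ c * _ := hC _ _ (hstate hu l h1 h2.le) (hu.isControl h1 h2)
      _ ≤ c * (a * cost μ S N w k (fun _ => 0) u + b * cost μ S N w k (fun _ => 0) u) :=
        mul_le_mul_of_nonneg_left (add_le_add (hA u hu) (hB u hu)) hc
      _ = _ := by ring
  have hbound : ∀ l, k ≤ l → l ≤ N → ∃ c : ℝ, 0 ≤ c ∧ ∀ u, Admissible μ N d t w k u →
      ip μ 1 (state S w k (fun _ => 0) u l) (state S w k (fun _ => 0) u l)
        ≤ c * cost μ S N w k (fun _ => 0) u := fun l hkl => by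
    induction l, hkl using Nat.le_induction with
    | base => exact fun _ => ⟨0, le_rfl, fun u _ => by rw [state_self, ip_zero_zero, zero_mul]⟩
    | succ l hl ih =>
      intro hlN
      obtain ⟨a, ha, hA⟩ := ih (by omega)
      obtain ⟨b, hb, hB⟩ := hctrl l hl hlN ⟨a, ha, hA⟩
      obtain ⟨c, hc, hC⟩ := exists_ip_one_next_le (d := d) (S := S) hw (htk.trans hl) hlN
      refine ⟨c * (a + b), by positivity, fun u hu => ?_⟩
      rw [state_succ hl]
      calc _ ≤ c * _ := hC _ _ (hstate hu l hl (by omega)) (hu.isControl hl hlN)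
        _ ≤ c * (a * cost μ S N w k (fun _ => 0) u + b * cost μ S N w k (fun _ => 0) u) :=
          mul_le_mul_of_nonneg_left (add_le_add (hA u hu) (hB u hu)) hc
        _ = _ := by ring
  -- The time range is moved inside the existential so that the constants form a function of all l.
  have hall : ∀ l, ∃ c : ℝ, 0 ≤ c ∧ (k ≤ l → l < N → ∀ u, Admissible μ N d t w k u →
      ip μ 1 (u l) (u l) ≤ c * cost μ S N w k (fun _ => 0) u) := fun l => by
    by_cases h : k ≤ l ∧ l < N
    · obtain ⟨c, hc, hC⟩ := hctrl l h.1 h.2 (hbound l h.1 h.2.le)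
      exact ⟨c, hc, fun _ _ => hC⟩
    · exact ⟨0, le_rfl, fun h1 h2 => absurd ⟨h1, h2⟩ h⟩
  choose c hc hC using hall
  have hs : 0 ≤ ∑ l ∈ Finset.Ico k N, c l := Finset.sum_nonneg fun l _ => hc l
  -- The added 1 keeps the inverse meaningful when all constants vanish; enlarging the sum is
  -- harmless since the cost is nonnegative.
  refine ⟨(∑ l ∈ Finset.Ico k N, c l + 1)⁻¹, by positivity, fun u hu => ?_⟩
  rw [inv_mul_le_iff₀ (by positivity)]
  have hnn : 0 ≤ cost μ S N w k (fun _ => 0) u := by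
    rw [hcost hu]
    exact Finset.sum_nonneg (hterm hu)
  calc ∑ l ∈ Finset.Ico k N, ∫ ω, u l ω ⬝ᵥ u l ω ∂μ
      ≤ ∑ l ∈ Finset.Ico k N, c l * cost μ S N w k (fun _ => 0) u :=
        Finset.sum_le_sum fun l hl => by
          simpa only [ip, one_mulVec] using
            hC l (Finset.mem_Ico.1 hl).1 (Finset.mem_Ico.1 hl).2 u hu
    _ = (∑ l ∈ Finset.Ico k N, c l) * cost μ S N w k (fun _ => 0) u := by rw [Finset.sum_mul]
    _ ≤ _ := by nlinarith

end Convexity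

end DelayedLQ

/-! ### The equivalences and the optimal control -/

theorem mainTheorem2 {Ω : Type*} [MeasurableSpace Ω] (μ : Measure Ω) [IsProbabilityMeasure μ]
    {n m : ℕ} (N d t : ℕ) (hd : 2 ≤ d) (ht : t < N) (S : DelayedLQ.LQData n m)
    (hQ : ∀ k, t ≤ k → k < N → (S.Q k).IsSymm)
    (hR : ∀ k, t ≤ k → k < N → (S.R k).IsSymm)
    (hG : S.G.IsSymm)
    (w : ℕ → Ω → ℝ) (hw : DelayedLQ.IsNoise μ N w)
    (x : Ω → Fin n → ℝ) (hx : Measurable[DelayedLQ.history w t] x) (hx2 : MemLp x 2 μ) :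
    [ DelayedLQ.UniquelySolvable μ S N d t w t x,
      ∃ P, DelayedLQ.IsRiccatiSolution S N d t P ∧
        ∀ k, t ≤ k → k < N → (DelayedLQ.W S d t P k).PosDef,
      DelayedLQ.UniformlyConvex μ S N d t w t,
      ∀ k, t ≤ k → k < N → DelayedLQ.UniformlyConvex μ S N d t w k,
      ∀ k, t ≤ k → k < N → ∀ ξ : Fin n → ℝ,
        DelayedLQ.UniquelySolvable μ S N d t w k (fun _ => ξ) ].TFAE ∧
    (DelayedLQ.UniquelySolvable μ S N d t w t x →
      ∀ P, DelayedLQ.IsRiccatiSolution S N d t P →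
        DelayedLQ.IsUniqueOptimal μ S N d t w t x
          (DelayedLQ.feedbackControl μ S d t w
            (fun l => (DelayedLQ.W S d t P l)⁻¹ * DelayedLQ.H S d t P l) t x) ∧
        ∀ k, t ≤ k → k < N → ∀ ξ : Fin n → ℝ,
          DelayedLQ.IsUniqueOptimal μ S N d t w k (fun _ => ξ)
            (DelayedLQ.feedbackControl μ S d t w
              (fun l => (DelayedLQ.W S d t P l)⁻¹ * DelayedLQ.H S d t P l) k (fun _ => ξ))) := by
  have hxs : DelayedLQ.IsState μ w t x := ⟨hx, hx2⟩
  have hpos : DelayedLQ.StrictlyPositive μ S N d t w →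
      ∀ k, t ≤ k → k < N → (DelayedLQ.W S d t (DelayedLQ.riccati S N d t) k).PosDef := fun h =>
    h.posDef hw hd hQ hR hG ht.le le_rfl
  have hexists : DelayedLQ.StrictlyPositive μ S N d t w →
      ∃ P, DelayedLQ.IsRiccatiSolution S N d t P ∧
        ∀ k, t ≤ k → k < N → (DelayedLQ.W S d t P k).PosDef := fun h =>
    ⟨_, DelayedLQ.isRiccatiSolution_riccati hd ht (hpos h), hpos h⟩
  have hcanon : (∃ P, DelayedLQ.IsRiccatiSolution S N d t P ∧
      ∀ k, t ≤ k → k < N → (DelayedLQ.W S d t P k).PosDef) →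
      ∀ k, t ≤ k → k < N → (DelayedLQ.W S d t (DelayedLQ.riccati S N d t) k).PosDef := by
    rintro ⟨P, hP, hW⟩ k h1 h2
    rw [← hP.W_eq hd h1 h2]
    exact hW k h1 h2
  have hopt : (∀ k, t ≤ k → k < N → (DelayedLQ.W S d t (DelayedLQ.riccati S N d t) k).PosDef) →
      ∀ K : ℕ → Matrix (Fin m) (Fin n) ℝ,
      (∀ l, t ≤ l → l < N → K l = DelayedLQ.gain S N d t l) → ∀ k, t ≤ k → k < N →
      ∀ ξ : Ω → Fin n → ℝ, DelayedLQ.IsState μ w k ξ → DelayedLQ.IsUniqueOptimal μ S N d t w k ξ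
        (DelayedLQ.feedbackControl μ S d t w K k ξ) := fun hW K hK k h1 h2 ξ hξ =>
    DelayedLQ.isUniqueOptimal_feedbackControl hw hd hQ hR hG h2.le h1
      (fun l hl => hW l (h1.trans hl)) hξ fun l hl => hK l (h1.trans hl)
  refine ⟨?_, fun h P hP => ?_⟩
  -- One initial state suffices, because the second-order part of the cost does not depend on it.
  · tfae_have 1 → 2 := fun h => hexists (h.strictlyPositive hw ht.le hxs)
    tfae_have 2 → 4 := fun h k h1 h2 =>
      DelayedLQ.uniformlyConvex_of_posDef hw hd hQ hR hG h2.le h1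
        fun l hl => hcanon h l (h1.trans hl)
    tfae_have 4 → 3 := fun h => h t le_rfl ht
    tfae_have 3 → 2 := fun h => hexists h.strictlyPositive
    tfae_have 2 → 5 := fun h k h1 h2 ξ =>
      ⟨_, hopt (hcanon h) _ (fun _ _ _ => rfl) k h1 h2 _ (DelayedLQ.isState_const ξ)⟩
    tfae_have 5 → 2 := fun h => hexists
      ((h t le_rfl ht 0).strictlyPositive hw ht.le (DelayedLQ.isState_const 0))
    tfae_have 2 → 1 := fun h => ⟨_, hopt (hcanon h) _ (fun _ _ _ => rfl) t le_rfl ht _ hxs⟩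
    tfae_finish
  · have hW := hpos (h.strictlyPositive hw ht.le hxs)
    -- An arbitrary solution may differ from the recursion only in entries that `W` and `H` do not
    -- read, so the gains coincide.
    have hK : ∀ l, t ≤ l → l < N → (DelayedLQ.W S d t P l)⁻¹ * DelayedLQ.H S d t P l
        = DelayedLQ.gain S N d t l := fun l h1 h2 => by
      rw [DelayedLQ.gain, hP.W_eq hd h1 h2, hP.H_eq hd h1 h2]
    exact ⟨hopt hW _ hK t le_rfl ht x hxs, fun k h1 h2 ξ =>
      hopt hW _ hK k h1 h2 _ (DelayedLQ.isState_const ξ)⟩
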